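/- Setting. Let $G$ be a finite group. A unitary modular invariant two-dimensional CFT with central charge $c>0$ and non-anomalous symmetry $G$ has, for every $h\in G$, a (defect) Hilbert space $\mathcal H_h$ on the circle twisted by $h$ ($\mathcal H_1$ is the untwisted sector), carrying two commuting unitary positive-energy actions of the Virasoro algebra of central charge $c$. Write $\mathcal H_{h,\Delta}$ for the subspace of states of scaling dimension $\Delta$ (on which $L_0+\bar L_0=\Delta$); these spaces are finite dimensional and the partition function of each sector converges for all $\beta>0$. The group $G$ acts on $\bigoplus_h\mathcal H_h$ by a genuine (non-projective) unitary representation, commuting with both Virasoro algebras, with $g\,\mathcal H_h\subseteq\mathcal H_{ghg^{-1}}$. The untwisted sector has a unique state with $\Delta=0$, the vacuum, and it is $G$-invariant. Let $$Z(\beta,h,g)=\operatorname{Tr}_{\mathcal H_h}\big(g\,e^{-\beta(L_0+\bar L_0-c/12)}\big)$$ (the trace is $0$ if $g$ and $h$ do not commute, since then $g$ maps $\mathcal H_h$ to another sector). Modular covariance under $S$ says $Z(\beta,h,g)=Z(4\pi^2/\beta,\,g,\,h^{-1})$ for all $\beta>0$, $g,h\in G$. For $g_0\in G$ with conjugacy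 class $[g_0]$ and a complex irreducible representation $\alpha$ of $G$ with dimension $d_\alpha$ and character $\chi_\alpha$, let $$n_{\alpha}(g_0,\Delta)=\frac{d_\alpha}{|[g_0]|}\,\dim\operatorname{Hom}_G\Big(\alpha,\bigoplus_{h\in[g_0]}\mathcal H_{h,\Delta}\Big),$$ the number of states of dimension $\Delta$ transforming in $\alpha$, per element of $[g_0]$; if $g_0$ is central this is the number of states of $\mathcal H_{g_0,\Delta}$ that transform in $\alpha$. Let $\rho_\alpha(g_0,\Delta')=\sum_{\Delta}n_\alpha(g_0,\Delta)\,\delta(\Delta'-\Delta)$ be the corresponding density of states, and $$\rho_0(\Delta)=\Big(\frac{c}{48\Delta^3}\Big)^{1/4}\exp\Big[2\pi\sqrt{\tfrac{c\Delta}{3}}\Big].$$ Theorem. Assume that $\mathcal H_g$ contains no state with $\Delta=0$ for $g\neq 1$. Then for every $g_0\in G$ and every irreducible representation $\alpha$ of $G$: (1) For all $\beta>0$, $$\sum_\Delta n_\alpha(g_0,\Delta)\,e^{-\beta(\Delta-c/12)}=\frac{d_\alpha}{|G|}\sum_{g\in G}Z(\beta,g_0,g)\,\overline{\chi_\alpha(g)},$$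 so $\rho_\alpha(g_0,\cdot)$ is the density of states of the partition function projected to $\alpha$ in the sector twisted by $g_0$. (2) For every $\delta>0$, as $\Delta\to\infty$, with $c_\pm=1\pm\frac1{2\delta}$, $$\frac{c_-\,d_\alpha^2}{|G|}\,\rho_0(\Delta)\;\lesssim\;\frac1{2\delta}\int_{[\Delta-\delta,\,\Delta+\delta]}d\Delta'\,\rho_\alpha(g_0,\Delta')\;\lesssim\;\frac{c_+\,d_\alpha^2}{|G|}\,\rho_0(\Delta),$$ in the asymptotic sense: for every $\varepsilon>0$ there is $\Delta_*$ such that for all $\Delta\ge\Delta_*$ the two inequalities hold with $c_-$ replaced by $c_--\varepsilon$ and $c_+$ replaced by $c_++\varepsilon$. -/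

import Mathlib

open Filter

noncomputable section

/-- The joint eigenspace `H_{h,Δ}`: vectors of the sector `h` with scaling dimension `Δ`, i.e. on
which `L₀ + L̄₀` acts as `Δ`. -/
def cftLevel {G V : Type*} [AddCommGroup V] [Module ℂ V]
    (sector : G → Submodule ℂ V) (L Lbar : ℤ → Module.End ℂ V) (h : G) (Δ : ℝ) :
    Submodule ℂ V :=
  sector h ⊓ Module.End.eigenspace (L 0 + Lbar 0) (Δ : ℂ)

/-- The operators `L n` satisfy the Virasoro algebra with central charge `c`. -/
def IsVirasoro {V : Type*} [AddCommGroup V] [Module ℂ V]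
    (c : ℝ) (L : ℤ → Module.End ℂ V) : Prop :=
  ∀ m n : ℤ, L m * L n - L n * L m
    = ((m : ℂ) - n) • L (m + n)
      + (if m + n = 0 then (((c : ℂ) / 12) * ((m : ℂ) ^ 3 - m)) • (1 : Module.End ℂ V) else 0)

/-- The state spaces of a unitary two-dimensional CFT with central charge `c` (both chiralities)
and a finite, non-anomalous global symmetry group `G`: the pre-Hilbert space `V = ⨁ h, H_h` of
finite-energy states of all sectors, where `H_h = sector h` is the (defect) Hilbert space on the
circle twisted by `h` and `H_1` is the untwisted one.  It carries commuting unitary actions of two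
Virasoro algebras.  Absence of an anomaly means that `G` acts by a genuine (not just projective)
representation on the twisted states; moving the line of `g` across a defect `h` gives the
defect `g h g⁻¹`. -/
structure SymmetricStateSpace (G V : Type*) [Group G]
    [NormedAddCommGroup V] [InnerProductSpace ℂ V] where
  /-- the central charge -/
  c : ℝ
  /-- the sector twisted by a group element -/
  sector : G → Submodule ℂ V
  /-- the left-moving Virasoro generators -/
  L : ℤ → Module.End ℂ V
  /-- the right-moving Virasoro generators -/
  Lbar : ℤ → Module.End ℂ V
  /-- the action of the symmetry group -/
  ρ : Representation ℂ G V
  sector_orthogonal : ∀ h h' : G, h ≠ h' → sector h ⟂ sector h'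
  sector_span : ⨆ h, sector h = ⊤
  virasoro_L : IsVirasoro c L
  virasoro_Lbar : IsVirasoro c Lbar
  L_comm_Lbar : ∀ m n : ℤ, Commute (L m) (Lbar n)
  L_adjoint : ∀ (n : ℤ) (v w : V), inner ℂ (L n v) w = inner ℂ v (L (-n) w)
  Lbar_adjoint : ∀ (n : ℤ) (v w : V), inner ℂ (Lbar n v) w = inner ℂ v (Lbar (-n) w)
  L_sector : ∀ (n : ℤ) (h : G), ∀ v ∈ sector h, L n v ∈ sector h
  Lbar_sector : ∀ (n : ℤ) (h : G), ∀ v ∈ sector h, Lbar n v ∈ sector h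
  /-- positive energy: `V` is spanned by states with conformal weights `(w, w') ≥ 0` -/
  weights_span : ⨆ w : NNReal × NNReal,
      (Module.End.eigenspace (L 0) ((w.1 : ℝ) : ℂ)
        ⊓ Module.End.eigenspace (Lbar 0) ((w.2 : ℝ) : ℂ)) = ⊤
  finite_level : ∀ (h : G) (Δ : ℝ), FiniteDimensional ℂ (cftLevel sector L Lbar h Δ)
  /-- the partition function of every sector converges at every temperature -/
  summable_level : ∀ (h : G) (β : ℝ), 0 < β →
    Summable fun Δ : ℝ => (Module.finrank ℂ (cftLevel sector L Lbar h Δ) : ℝ) * Real.exp (-β * Δ)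
  ρ_unitary : ∀ (g : G) (v w : V), inner ℂ (ρ g v) (ρ g w) = inner ℂ v w
  ρ_sector : ∀ g h : G, ∀ v ∈ sector h, ρ g v ∈ sector (g * h * g⁻¹)
  ρ_comm_L : ∀ (g : G) (n : ℤ) (v : V), ρ g (L n v) = L n (ρ g v)
  ρ_comm_Lbar : ∀ (g : G) (n : ℤ) (v : V), ρ g (Lbar n v) = Lbar n (ρ g v)
  /-- the vacuum -/
  vac : V
  vac_ne_zero : vac ≠ 0
  /-- the vacuum is the unique state of dimension `0` in the untwisted sector -/
  vac_unique : cftLevel sector L Lbar 1 0 = Submodule.span ℂ {vac}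
  ρ_vac : ∀ g : G, ρ g vac = vac

namespace SymmetricStateSpace

variable {G V : Type*} [Group G] [NormedAddCommGroup V] [InnerProductSpace ℂ V]

/-- `H_{h,Δ}`: the states of dimension `Δ` in the sector twisted by `h`. -/
def level (X : SymmetricStateSpace G V) (h : G) (Δ : ℝ) : Submodule ℂ V :=
  cftLevel X.sector X.L X.Lbar h Δ

instance (X : SymmetricStateSpace G V) (h : G) (Δ : ℝ) : FiniteDimensional ℂ (X.level h Δ) :=
  X.finite_level h Δ

/-- The trace of `g` over `H_{h,Δ}`, i.e. the trace of the compression of `ρ g` to this space.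
If `g` commutes with `h` then `ρ g` maps `H_{h,Δ}` to itself; otherwise it maps it to an orthogonal
sector and the trace is zero. -/
def levelTrace (X : SymmetricStateSpace G V) (h g : G) (Δ : ℝ) : ℂ :=
  LinearMap.trace ℂ (X.level h Δ)
    ((X.level h Δ).orthogonalProjectionOnto.toLinearMap ∘ₗ X.ρ g ∘ₗ (X.level h Δ).subtype)

/-- The torus partition function `Z(β, h, g) = Tr_{H_h} (g e^{-β (L₀ + L̄₀ - c/12)})`, with the line
of `h` along the temporal and that of `g` along the spatial circle. -/
def Z (X : SymmetricStateSpace G V) (β : ℝ) (h g : G) : ℂ :=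
  ∑' Δ : ℝ, X.levelTrace h g Δ * (Real.exp (-β * (Δ - X.c / 12)) : ℂ)

/-- The states of dimension `Δ` in the sectors twisted by the conjugates of `g₀`; this is the
smallest `G`-invariant space containing `H_{g₀,Δ}`, and equals `H_{g₀,Δ}` for central `g₀`. -/
def classLevel (X : SymmetricStateSpace G V) (g₀ : G) (Δ : ℝ) : Submodule ℂ V :=
  ⨆ k : G, X.level (k * g₀ * k⁻¹) Δ

/-- The space `Hom_G(α, classLevel g₀ Δ)` of intertwiners. -/
def homSpace (X : SymmetricStateSpace G V) {W : Type*} [AddCommGroup W] [Module ℂ W]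
    (α : Representation ℂ G W) (g₀ : G) (Δ : ℝ) : Submodule ℂ (W →ₗ[ℂ] V) where
  carrier := {f | (∀ (g : G) (w : W), f (α g w) = X.ρ g (f w)) ∧ ∀ w, f w ∈ X.classLevel g₀ Δ}
  add_mem' := fun {a b} ha hb =>
    ⟨fun g w => by simp [ha.1 g w, hb.1 g w], fun w => Submodule.add_mem _ (ha.2 w) (hb.2 w)⟩
  zero_mem' := ⟨fun g w => by simp, fun w => Submodule.zero_mem _⟩
  smul_mem' := fun r a ha =>
    ⟨fun g w => by simp [ha.1 g w], fun w => Submodule.smul_mem _ r (ha.2 w)⟩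

/-- The number of states of dimension `Δ` transforming in the irrep `α`, per element of the
conjugacy class of `g₀`: the dimension of `α` times its multiplicity in `classLevel g₀ Δ`, divided
by the size of the conjugacy class.  The measure `∑ Δ, irrepCount α g₀ Δ • δ_Δ` is the density of
states of the irrep `α` in the sector twisted by `g₀`. -/
def irrepCount (X : SymmetricStateSpace G V) {W : Type*} [AddCommGroup W] [Module ℂ W]
    (α : Representation ℂ G W) (g₀ : G) (Δ : ℝ) : ℝ :=
  (Module.finrank ℂ W * Module.finrank ℂ (X.homSpace α g₀ Δ) : ℝ)
    / Nat.card {h : G // IsConj g₀ h}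

/-- Below any energy only finitely many scaling dimensions occur, so that the sum of `irrepCount`
over a bounded window is a finite sum. -/
theorem irrepCount_finite [Finite G] (X : SymmetricStateSpace G V) {W : Type*} [AddCommGroup W]
    [Module ℂ W] (α : Representation ℂ G W) (g₀ : G) (R : ℝ) :
    {Δ : ℝ | Δ ≤ R ∧ X.irrepCount α g₀ Δ ≠ 0}.Finite := by
  have key : ∀ h : G, {Δ : ℝ | Δ ≤ R ∧ X.level h Δ ≠ ⊥}.Finite := by
    intro h
    have hs := (X.summable_level h 1 one_pos).tendsto_cofinite_zero
    have hev := hs.eventually (gt_mem_nhds (Real.exp_pos (-1 * R)))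
    rw [Filter.eventually_cofinite] at hev
    refine hev.subset ?_
    rintro Δ ⟨hΔ, hne⟩
    simp only [Set.mem_ofPred_eq, not_lt]
    have h1 : (1 : ℝ) ≤ (Module.finrank ℂ (cftLevel X.sector X.L X.Lbar h Δ) : ℝ) := by
      have h2 : FiniteDimensional ℂ (cftLevel X.sector X.L X.Lbar h Δ) := X.finite_level h Δ
      have : Module.finrank ℂ (cftLevel X.sector X.L X.Lbar h Δ) ≠ 0 := fun h0 =>
        hne (Submodule.finrank_eq_zero.mp h0)
      exact_mod_cast Nat.one_le_iff_ne_zero.mpr this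
    have h3 : Real.exp (-1 * R) ≤ Real.exp (-1 * Δ) := Real.exp_le_exp.mpr (by linarith)
    nlinarith [Real.exp_pos (-1 * Δ)]
  refine (Set.finite_iUnion fun k : G => key (k * g₀ * k⁻¹)).subset ?_
  rintro Δ ⟨hΔ, hne⟩
  by_contra hcon
  simp only [Set.mem_iUnion, Set.mem_ofPred_eq, not_exists, not_and, not_not] at hcon
  apply hne
  have hcl : X.classLevel g₀ Δ = ⊥ := by
    simp only [classLevel, iSup_eq_bot]
    exact fun k => hcon k hΔ
  have hh : X.homSpace α g₀ Δ = ⊥ := by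
    rw [eq_bot_iff]
    intro f hf
    ext w
    have := hf.2 w
    rw [hcl] at this
    simpa using this
  have h0 : Module.finrank ℂ (X.homSpace α g₀ Δ) = 0 := by rw [hh]; exact finrank_bot ℂ _
  simp only [irrepCount, h0, Nat.cast_zero, mul_zero, zero_div]

end SymmetricStateSpace

/-- A unitary modular invariant two-dimensional CFT with finite non-anomalous symmetry group `G`:
the modular transformation `S` exchanges the two cycles of the torus, and with them the lines
wrapping them, without any phase. -/
structure SymmetricCFT (G V : Type*) [Group G]
    [NormedAddCommGroup V] [InnerProductSpace ℂ V] extends SymmetricStateSpace G V where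
  S_covariant : ∀ (β : ℝ), 0 < β → ∀ h g : G,
    toSymmetricStateSpace.Z β h g = toSymmetricStateSpace.Z (4 * Real.pi ^ 2 / β) g h⁻¹

/-- The Cardy density `ρ₀(Δ) = (c / (48 Δ³))^{1/4} exp (2π √(c Δ / 3))`. -/
def cardyDensity (c Δ : ℝ) : ℝ :=
  (c / (48 * Δ ^ 3)) ^ (1 / 4 : ℝ) * Real.exp (2 * Real.pi * Real.sqrt (c * Δ / 3))

end

/-! ### Multiplicities of irreps as character sums of twisted traces -/

noncomputable section

/-! Write `A = π² c / 3` and let `d` be the dimension of `α`. Orthogonality of characters expresses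
the count of states in `α` as an average of twisted traces against `conj χ_α` (`irrepCount_eq`);
summing over energies gives the projected partition function. Its Laplace variable may be taken
complex, `s = β + iτ`. The modular transformation, continued to complex `s` by the identity theorem
(`laplaceTrace_S`), turns the inserted element `g` into the twist of the dual channel. By the gap
assumption only `g = 1` has a state of dimension zero there, namely the vacuum, on which every group
element acts trivially. So the leading term is `(d² / |G|) e^{-sc/12} e^{A/s}`: one factor `d` is
the prefactor of the projector, the other is `χ_α(1)`.

The remaining dual states are split at dimension `c/12` (`exp_mul_excitedSum_le`). The light ones
are suppressed by the gap above the vacuum. The heavy ones are bounded by a second modular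
transformation, which gains exactly when `|s| < 2π`. Hence, for every `Λ < 1`, the error on the
segment `|τ| ≤ 2πΛ` is `O(e^{θA/β})` with some `θ < 1` (`exists_laplace_bound`).

The rest is a Tauberian theorem (`eventually_window_bounds`). The Beurling-Selberg majorant and
minorant of `[-δ, δ]` with frequencies in `[-2πΛ, 2πΛ]` have integrals `2δ ± 1/Λ`
(`indicator_le_selberg`, `selberg_le_indicator`, `tendsto_selbergDensity`). Smearing the spectrum
around `Δ` with such a function needs the Laplace transform only on the controlled segment. At the
saddle `β = √(A/Δ)` the vacuum term concentrates at `τ = 0` in a Gaussian, so only the integral of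
the smearing function survives (`tendsto_bandlimited`), and the Gaussian normalisation reproduces
`cardyDensity`. Letting `Λ` approach `1` gives the constants `1 ± 1/(2δ)`. -/

open scoped ComplexOrder in
/-- Characters of finite-dimensional complex representations of a finite group satisfy
`χ(g⁻¹) = conj χ(g)`. -/
theorem Representation.character_inv_eq_conj {G W : Type*} [Group G] [Finite G] [AddCommGroup W]
    [Module ℂ W] [FiniteDimensional ℂ W] (α : Representation ℂ G W) (g : G) :
    α.character g⁻¹ = (starRingEnd ℂ) (α.character g) := by
  classical
  have := Fintype.ofFinite G
  let b := Module.finBasis ℂ W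
  let M : G → Matrix (Fin (Module.finrank ℂ W)) (Fin (Module.finrank ℂ W)) ℂ :=
    fun g => LinearMap.toMatrix b b (α g)
  have hmul : ∀ g h, M (g * h) = M g * M h := fun g h => by
    simp only [M, map_mul, Module.End.mul_eq_comp]
    exact LinearMap.toMatrix_comp b b b _ _
  have hone : M 1 = 1 := by simp [M]
  -- The averaged Hermitian form is invariant and positive definite, so `M g⁻¹` is the adjoint of `M
  -- g` with respect to it; comparing traces gives the claim. The summand `h = 1` is what makes it
  -- definite.
  let P := ∑ h : G, (M h).conjTranspose * M h
  have hP : P.PosDef := by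
    have : P = 1 + ∑ h ∈ Finset.univ.erase (1 : G), (M h).conjTranspose * M h := by
      simp only [P]
      rw [← Finset.add_sum_erase _ _ (Finset.mem_univ (1 : G)), hone]; simp
    rw [this]
    refine Matrix.PosDef.one.add_posSemidef ?_
    exact Matrix.posSemidef_sum _ fun h _ => Matrix.posSemidef_conjTranspose_mul_self _
  have hinv : (M g).conjTranspose * P * M g = P := by
    simp only [P, Finset.mul_sum, Finset.sum_mul]
    refine Fintype.sum_equiv (Equiv.mulRight g) _ _ fun h => ?_
    simp only [Equiv.coe_mulRight, hmul, Matrix.conjTranspose_mul, Matrix.mul_assoc]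
  have hgi : M g * M g⁻¹ = 1 := by rw [← hmul, mul_inv_cancel, hone]
  have hconj : (M g).conjTranspose * P = P * M g⁻¹ := by
    conv_rhs => rw [← hinv]
    rw [Matrix.mul_assoc _ (M g), hgi, Matrix.mul_one]
  have hu : IsUnit P.det := (Matrix.isUnit_iff_isUnit_det _).1 hP.isUnit
  have ht : ∀ g, α.character g = (M g).trace := fun g => by
    simp only [Representation.character, M]; rw [LinearMap.trace_eq_matrix_trace ℂ b]
  rw [ht, ht, starRingEnd_apply, ← Matrix.trace_conjTranspose]
  calc (M g⁻¹).trace = (P⁻¹ * (P * M g⁻¹)).trace := by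
        rw [← Matrix.mul_assoc, Matrix.nonsing_inv_mul _ hu, Matrix.one_mul]
    _ = ((M g).conjTranspose * P * P⁻¹).trace := by rw [← hconj, Matrix.trace_mul_comm]
    _ = _ := by rw [Matrix.mul_assoc, Matrix.mul_nonsing_inv _ hu, Matrix.mul_one]

namespace SymmetricStateSpace

variable {G V : Type*} [Group G] [NormedAddCommGroup V] [InnerProductSpace ℂ V]
  (X : SymmetricStateSpace G V)

theorem level_orthogonalFamily (Δ : ℝ) :
    OrthogonalFamily ℂ (fun h : G => X.level h Δ) fun h => (X.level h Δ).subtypeₗᵢ := by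
  refine OrthogonalFamily.of_pairwise fun h h' hne => ?_
  exact (X.sector_orthogonal h h' hne).mono inf_le_left inf_le_left

theorem mem_level {h : G} {Δ : ℝ} {v : V} :
    v ∈ X.level h Δ ↔ v ∈ X.sector h ∧ X.L 0 v + X.Lbar 0 v = (Δ : ℂ) • v := by
  simp [level, cftLevel]

theorem map_mem_level (g : G) {h : G} {Δ : ℝ} {v : V} (hv : v ∈ X.level h Δ) :
    X.ρ g v ∈ X.level (g * h * g⁻¹) Δ := by
  rw [mem_level] at hv ⊢
  refine ⟨X.ρ_sector g h v hv.1, ?_⟩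
  rw [← X.ρ_comm_L, ← X.ρ_comm_Lbar, ← map_add, hv.2, map_smul]

/-- Positivity of the energy. -/
theorem level_eq_bot_of_neg (h : G) {Δ : ℝ} (hΔ : Δ < 0) : X.level h Δ = ⊥ := by
  rw [eq_bot_iff]
  intro v hv
  rw [mem_level] at hv
  have hsymm : ∀ x y : V, inner ℂ (X.L 0 x + X.Lbar 0 x) y = inner ℂ x (X.L 0 y + X.Lbar 0 y) := by
    intro x y
    rw [inner_add_left, inner_add_right, X.L_adjoint, X.Lbar_adjoint, neg_zero]
  -- Eigenvectors of a symmetric operator with different eigenvalues are orthogonal, and the joint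
  -- eigenspaces of nonnegative weight span everything, so `v` is orthogonal to the whole space.
  have hle : (⊤ : Submodule ℂ V) ≤ (Submodule.span ℂ {v})ᗮ := by
    rw [← X.weights_span]
    refine iSup_le fun w x hx => ?_
    rw [Submodule.mem_inf, Module.End.mem_eigenspace_iff, Module.End.mem_eigenspace_iff] at hx
    rw [Submodule.mem_orthogonal_singleton_iff_inner_right]
    have h1 := hsymm v x
    rw [hv.2, hx.1, hx.2, inner_smul_left, ← add_smul, inner_smul_right, Complex.conj_ofReal] at h1
    have h2 : ((Δ : ℂ) - ((w.1 : ℝ) + (w.2 : ℝ) : ℂ)) * inner ℂ v x = 0 := by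
      rw [sub_mul, h1, sub_self]
    refine (mul_eq_zero.1 h2).resolve_left fun h3 => ?_
    have h4 : Δ - (w.1 + w.2 : ℝ) = 0 := by exact_mod_cast h3
    have := w.1.2; have := w.2.2
    have : (0 : ℝ) ≤ w.1 + w.2 := by positivity
    linarith
  have := hle (Submodule.mem_top (x := v))
  rw [Submodule.mem_orthogonal_singleton_iff_inner_right] at this
  simpa using this

/-- The action of `g` as an equivalence between the level spaces of conjugate sectors. -/
def levelEquiv (g h : G) (Δ : ℝ) : X.level h Δ ≃ₗ[ℂ] X.level (g * h * g⁻¹) Δ where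
  toFun v := ⟨X.ρ g v, X.map_mem_level g v.2⟩
  invFun v := ⟨X.ρ g⁻¹ v, by
    have := X.map_mem_level g⁻¹ v.2
    rwa [show g⁻¹ * (g * h * g⁻¹) * g⁻¹⁻¹ = h by group] at this⟩
  map_add' v w := by ext; simp
  map_smul' r v := by ext; simp
  left_inv v := by ext; simp
  right_inv v := by ext; simp

/-- Unitarity of `ρ k` makes it intertwine the orthogonal projections onto the two levels (`key`),
so the two compressions are conjugate. This lets all members of a conjugacy class contribute equally
to a character sum. -/
theorem levelTrace_conj (k h g : G) (Δ : ℝ) :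
    X.levelTrace (k * h * k⁻¹) (k * g * k⁻¹) Δ = X.levelTrace h g Δ := by
  unfold levelTrace
  rw [← LinearMap.trace_conj' _ (X.levelEquiv k h Δ)]
  congr 1
  ext v
  obtain ⟨v, hv⟩ := v
  have hk : X.ρ k⁻¹ v ∈ X.level h Δ := ((X.levelEquiv k h Δ).symm ⟨v, hv⟩).2
  have h1 : ((X.levelEquiv k h Δ).symm ⟨v, hv⟩) = ⟨X.ρ k⁻¹ v, hk⟩ := rfl
  have key : ∀ u : V, (X.level (k * h * k⁻¹) Δ).orthogonalProjectionOnto (X.ρ k u)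
      = X.levelEquiv k h Δ ((X.level h Δ).orthogonalProjectionOnto u) := by
    intro u
    refine ext_inner_left ℂ fun w => ?_
    rw [Submodule.inner_orthogonalProjectionOnto_eq_of_mem_left]
    obtain ⟨w, rfl⟩ := (X.levelEquiv k h Δ).surjective w
    change inner ℂ (X.ρ k w) (X.ρ k u)
      = inner ℂ (X.ρ k w) (X.ρ k ((X.level h Δ).orthogonalProjectionOnto u))
    rw [X.ρ_unitary, X.ρ_unitary, ← Submodule.coe_inner,
      Submodule.inner_orthogonalProjectionOnto_eq_of_mem_left]
  simp [LinearEquiv.conj_apply, h1, key]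

/-- In an orthonormal basis, each diagonal entry of the compression of an isometry has modulus at
most one. -/
theorem norm_levelTrace_le (h g : G) (Δ : ℝ) :
    ‖X.levelTrace h g Δ‖ ≤ Module.finrank ℂ (X.level h Δ) := by
  let b := stdOrthonormalBasis ℂ (X.level h Δ)
  rw [levelTrace, LinearMap.trace_eq_sum_inner _ b]
  refine (norm_sum_le _ _).trans ?_
  calc _ ≤ ∑ i : Fin (Module.finrank ℂ (X.level h Δ)), (1 : ℝ) := by
        refine Finset.sum_le_sum fun i _ => ?_
        refine (norm_inner_le_norm _ _).trans ?_
        rw [b.norm_eq_one, one_mul]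
        refine ((X.level h Δ).norm_orthogonalProjectionOnto_apply_le _).trans ?_
        have h1 : ‖X.ρ g (b i : V)‖ = ‖(b i : V)‖ := by
          rw [@norm_eq_sqrt_re_inner ℂ, @norm_eq_sqrt_re_inner ℂ, X.ρ_unitary]
        exact h1.le.trans_eq (b.norm_eq_one i)
    _ = _ := by simp

/-- Indexing by `k` repeats a sector once for each element of a centralizer coset. Indexing by the
class itself removes the repetitions, so that the family becomes orthogonal. -/
theorem classLevel_eq_iSup (g₀ : G) (Δ : ℝ) :
    X.classLevel g₀ Δ = ⨆ h : {h : G // IsConj g₀ h}, X.level h Δ := by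
  refine le_antisymm (iSup_le fun k => ?_) (iSup_le fun h => ?_)
  · exact le_iSup (fun h : {h : G // IsConj g₀ h} => X.level h Δ)
      ⟨k * g₀ * k⁻¹, isConj_iff.2 ⟨k, rfl⟩⟩
  · obtain ⟨k, hk⟩ := isConj_iff.1 h.2
    rw [← hk]
    exact le_iSup (fun k : G => X.level (k * g₀ * k⁻¹) Δ) k

theorem level_le_classLevel {g₀ h : G} (hh : IsConj g₀ h) (Δ : ℝ) :
    X.level h Δ ≤ X.classLevel g₀ Δ := by
  rw [classLevel_eq_iSup]
  exact le_iSup (fun h : {h : G // IsConj g₀ h} => X.level h Δ) ⟨h, hh⟩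

instance [Finite G] (g₀ : G) (Δ : ℝ) : FiniteDimensional ℂ (X.classLevel g₀ Δ) :=
  Submodule.finite_iSup _

theorem map_mem_classLevel (g : G) {g₀ : G} {Δ : ℝ} {v : V} (hv : v ∈ X.classLevel g₀ Δ) :
    X.ρ g v ∈ X.classLevel g₀ Δ := by
  suffices X.classLevel g₀ Δ ≤ (X.classLevel g₀ Δ).comap (X.ρ g) from this hv
  refine iSup_le fun k x hx => ?_
  refine X.level_le_classLevel ?_ Δ (X.map_mem_level g hx)
  exact isConj_iff.2 ⟨g * k, by group⟩

/-- The representation of `G` on the states of dimension `Δ` in the sectors conjugate to `g₀`. -/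
def classRep (g₀ : G) (Δ : ℝ) : Representation ℂ G (X.classLevel g₀ Δ) where
  toFun g := (X.ρ g).restrict fun _ hv => X.map_mem_classLevel g hv
  map_one' := by ext; simp
  map_mul' g h := by ext; simp

/-- The trace of a block operator is the sum of the traces of its diagonal blocks: insert the
resolution of the identity by the sector projections and use cyclicity. -/
theorem classRep_character [Finite G] [Fintype {h : G // IsConj g₀ h}] (Δ : ℝ) (g : G) :
    (X.classRep g₀ Δ).character g = ∑ h : {h : G // IsConj g₀ h}, X.levelTrace h g Δ := by
  let ι (h : {h : G // IsConj g₀ h}) : X.level h Δ →ₗ[ℂ] X.classLevel g₀ Δ :=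
    Submodule.inclusion (X.level_le_classLevel h.2 Δ)
  let P (h : {h : G // IsConj g₀ h}) : X.classLevel g₀ Δ →ₗ[ℂ] X.level h Δ :=
    (X.level h Δ).orthogonalProjectionOnto.toLinearMap ∘ₗ (X.classLevel g₀ Δ).subtype
  have hsum : ∑ h, ι h ∘ₗ P h = LinearMap.id := by
    ext v
    have hv : (v : V) ∈ ⨆ h : {h : G // IsConj g₀ h}, X.level h Δ :=
      (X.classLevel_eq_iSup g₀ Δ).le v.2
    have hfam : OrthogonalFamily ℂ (fun h : {h : G // IsConj g₀ h} => X.level h Δ)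
        fun h => (X.level h Δ).subtypeₗᵢ :=
      (X.level_orthogonalFamily Δ).comp Subtype.val_injective
    have := hfam.sum_projection_of_mem_iSup _ hv
    conv_rhs => rw [LinearMap.id_apply, ← this]
    simp [ι, P]
  calc (X.classRep g₀ Δ).character g
      = LinearMap.trace ℂ _ (X.classRep g₀ Δ g ∘ₗ ∑ h, ι h ∘ₗ P h) := by
        rw [hsum, LinearMap.comp_id]; rfl
    _ = ∑ h, LinearMap.trace ℂ _ ((X.classRep g₀ Δ g ∘ₗ ι h) ∘ₗ P h) := by
        rw [← map_sum]; congr 1; ext v; simp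
    _ = ∑ h : {h : G // IsConj g₀ h}, X.levelTrace h g Δ := by
        refine Finset.sum_congr rfl fun h _ => ?_
        rw [LinearMap.trace_comp_comm']
        rfl

/-- The intertwiners into the ambient space with image in `classLevel` are the intertwiners
into `classLevel`. -/
def homSpaceEquiv {W : Type*} [AddCommGroup W] [Module ℂ W] (α : Representation ℂ G W) (g₀ : G)
    (Δ : ℝ) : X.homSpace α g₀ Δ ≃ₗ[ℂ] Representation.IntertwiningMap α (X.classRep g₀ Δ) where
  toFun f := ⟨f.1.codRestrict _ f.2.2, fun g => by ext w; exact f.2.1 g w⟩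
  invFun f := ⟨(X.classLevel g₀ Δ).subtype ∘ₗ f.toLinearMap, fun g w => by
    have := LinearMap.congr_fun (f.isIntertwining' g) w
    exact congrArg Subtype.val this, fun w => (f.toLinearMap w).2⟩
  map_add' f g := by ext; rfl
  map_smul' r f := by ext; rfl
  left_inv f := by ext; rfl
  right_inv f := by ext; rfl

/-- The dimension of the space of intertwiners is the inner product of characters. By conjugation
invariance each sector of the class gives the same sum over the group, so the class size cancels the
normalisation in `irrepCount`. -/
theorem irrepCount_eq [Fintype G] {W : Type*} [AddCommGroup W] [Module ℂ W]
    [FiniteDimensional ℂ W] (α : Representation ℂ G W) (g₀ : G) (Δ : ℝ) :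
    (X.irrepCount α g₀ Δ : ℂ) = (Module.finrank ℂ W : ℂ) / (Fintype.card G : ℂ)
      * ∑ g : G, X.levelTrace g₀ g Δ * (starRingEnd ℂ) (α.character g) := by
  classical
  have hG : (Nat.card G : ℂ) ≠ 0 := by exact_mod_cast Nat.card_pos.ne'
  have : Invertible (Nat.card G : ℂ) := invertibleOfNonzero hG
  have : Nonempty {h : G // IsConj g₀ h} := ⟨⟨g₀, IsConj.refl _⟩⟩
  have hC : (Nat.card {h : G // IsConj g₀ h} : ℂ) ≠ 0 := by
    exact_mod_cast Nat.card_pos.ne'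
  have h1 := Representation.card_inv_mul_sum_char_mul_char_eq_finrank α (X.classRep g₀ Δ)
  rw [← (X.homSpaceEquiv α g₀ Δ).finrank_eq] at h1
  have h2 : ∀ h : {h : G // IsConj g₀ h},
      ∑ g : G, X.levelTrace h g Δ * (starRingEnd ℂ) (α.character g)
        = ∑ g : G, X.levelTrace g₀ g Δ * (starRingEnd ℂ) (α.character g) := by
    intro h
    obtain ⟨k, hk⟩ := isConj_iff.1 h.2
    symm
    refine Fintype.sum_equiv (MulAut.conj k).toEquiv _ _ fun g => ?_
    change _ = X.levelTrace h (k * g * k⁻¹) Δ * (starRingEnd ℂ) (α.character (k * g * k⁻¹))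
    rw [← hk, X.levelTrace_conj, Representation.char_conj]
  have h3 : ∑ g : G, (X.classRep g₀ Δ).character g * α.character g⁻¹
      = Nat.card {h : G // IsConj g₀ h}
        * ∑ g : G, X.levelTrace g₀ g Δ * (starRingEnd ℂ) (α.character g) := by
    simp only [classRep_character, Representation.character_inv_eq_conj, Finset.sum_mul]
    rw [Finset.sum_comm]
    simp [h2, Nat.card_eq_fintype_card]
  rw [h3] at h1
  rw [irrepCount]
  push_cast
  rw [← h1, Nat.card_eq_fintype_card (α := G)]
  field_simp

theorem irrepCount_nonneg {W : Type*} [AddCommGroup W] [Module ℂ W]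
    (α : Representation ℂ G W) (g₀ : G) (Δ : ℝ) : 0 ≤ X.irrepCount α g₀ Δ := by
  unfold irrepCount; positivity

theorem levelTrace_eq_zero {h : G} {Δ : ℝ} (hb : X.level h Δ = ⊥) (g : G) :
    X.levelTrace h g Δ = 0 := by
  have := X.norm_levelTrace_le h g Δ
  rw [hb, finrank_bot, Nat.cast_zero] at this
  exact norm_le_zero_iff.1 this

theorem norm_exp_neg_mul (s : ℂ) (x : ℝ) : ‖Complex.exp (-s * x)‖ = Real.exp (-s.re * x) := by
  rw [Complex.norm_exp]; simp

theorem norm_levelTrace_mul_exp_le (h g : G) (s : ℂ) (Δ : ℝ) :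
    ‖X.levelTrace h g Δ * Complex.exp (-s * Δ)‖
      ≤ (Module.finrank ℂ (X.level h Δ) : ℝ) * Real.exp (-s.re * Δ) := by
  rw [norm_mul, norm_exp_neg_mul]
  exact mul_le_mul_of_nonneg_right (X.norm_levelTrace_le h g Δ) (Real.exp_nonneg _)

theorem summable_levelTrace_mul_exp (h g : G) {s : ℂ} (hs : 0 < s.re) :
    Summable fun Δ : ℝ => X.levelTrace h g Δ * Complex.exp (-s * Δ) :=
  .of_norm_bounded (X.summable_level h s.re hs) (X.norm_levelTrace_mul_exp_le h g s)

/-- The partition function without the vacuum energy factor, at complex inverse temperature. -/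
def laplaceTrace (h g : G) (s : ℂ) : ℂ :=
  ∑' Δ : ℝ, X.levelTrace h g Δ * Complex.exp (-s * Δ)

theorem Z_eq (β : ℝ) (h g : G) :
    X.Z β h g = Complex.exp (β * (X.c / 12)) * X.laplaceTrace h g β := by
  unfold Z laplaceTrace
  rw [← tsum_mul_left]
  congr 1; ext Δ
  rw [Complex.ofReal_exp, mul_left_comm, ← Complex.exp_add]
  congr 2; push_cast; ring

theorem hasSum_irrepCount_mul_exp [Fintype G] {W : Type*} [AddCommGroup W] [Module ℂ W]
    [FiniteDimensional ℂ W] (α : Representation ℂ G W) (g₀ : G) {s : ℂ} (hs : 0 < s.re) :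
    HasSum (fun Δ : ℝ => (X.irrepCount α g₀ Δ : ℂ) * Complex.exp (-s * Δ))
      ((Module.finrank ℂ W : ℂ) / (Fintype.card G : ℂ)
        * ∑ g : G, X.laplaceTrace g₀ g s * (starRingEnd ℂ) (α.character g)) := by
  simp only [X.irrepCount_eq, mul_assoc, Finset.sum_mul]
  refine HasSum.mul_left _ (hasSum_sum fun g _ => ?_)
  have h := (X.summable_levelTrace_mul_exp g₀ g hs).hasSum.mul_right
    ((starRingEnd ℂ) (α.character g))
  have e : (fun Δ : ℝ => X.levelTrace g₀ g Δ * Complex.exp (-s * Δ)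
      * (starRingEnd ℂ) (α.character g)) = fun Δ : ℝ => X.levelTrace g₀ g Δ
      * ((starRingEnd ℂ) (α.character g) * Complex.exp (-s * Δ)) := by
    funext Δ; ring
  rwa [e] at h

theorem hasSum_irrepCount [Fintype G] {W : Type*} [AddCommGroup W] [Module ℂ W]
    [FiniteDimensional ℂ W] (α : Representation ℂ G W) (g₀ : G) {β : ℝ} (hβ : 0 < β) :
    HasSum (fun Δ : ℝ =>
        (X.irrepCount α g₀ Δ : ℂ) * (Real.exp (-β * (Δ - X.c / 12)) : ℂ))
      ((Module.finrank ℂ W : ℂ) / (Fintype.card G : ℂ)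
        * ∑ g : G, X.Z β g₀ g * (starRingEnd ℂ) (α.character g)) := by
  have := (X.hasSum_irrepCount_mul_exp α g₀ (s := β) (by simpa using hβ)).mul_left
    (Complex.exp (β * (X.c / 12)))
  have e : (fun Δ : ℝ => (X.irrepCount α g₀ Δ : ℂ) * (Real.exp (-β * (Δ - X.c / 12)) : ℂ))
      = fun Δ : ℝ => Complex.exp (β * (X.c / 12))
        * ((X.irrepCount α g₀ Δ : ℂ) * Complex.exp (-β * Δ)) := by
    funext Δ
    rw [Complex.ofReal_exp, mul_left_comm, ← Complex.exp_add]
    congr 2; push_cast; ring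
  rw [e]
  convert! this using 1
  simp only [Z_eq, mul_assoc]
  rw [← Finset.mul_sum, mul_left_comm]

end SymmetricStateSpace

/-! ### Analyticity of the twisted traces, the vacuum and the excited states -/

namespace SymmetricStateSpace

variable {G V : Type*} [Group G] [NormedAddCommGroup V] [InnerProductSpace ℂ V]
  (X : SymmetricStateSpace G V)

theorem finrank_mul_exp_anti (h : G) (Δ : ℝ) {b b' : ℝ} (hb : b ≤ b') :
    (Module.finrank ℂ (X.level h Δ) : ℝ) * Real.exp (-b' * Δ)
      ≤ (Module.finrank ℂ (X.level h Δ) : ℝ) * Real.exp (-b * Δ) := by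
  rcases lt_or_ge Δ 0 with hΔ | hΔ
  · rw [X.level_eq_bot_of_neg h hΔ, finrank_bot]; simp
  · have : -b' * Δ ≤ -b * Δ := by nlinarith
    gcongr

/-- On the half plane to the right of `s.re / 2` the series is dominated termwise by a convergent
partition function, positivity of the energy making the exponentials monotone in the temperature. -/
theorem differentiableOn_laplaceTrace (h g : G) :
    DifferentiableOn ℂ (X.laplaceTrace h g) {s | 0 < s.re} := by
  intro s hs
  have hs : 0 < s.re := hs
  have hopen : IsOpen {z : ℂ | s.re / 2 < z.re} := isOpen_lt continuous_const Complex.continuous_re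
  have := Complex.differentiableOn_tsum_of_summable_norm
    (F := fun (Δ : ℝ) (z : ℂ) => X.levelTrace h g Δ * Complex.exp (-z * Δ))
    (X.summable_level h (s.re / 2) (by positivity))
    (fun Δ => by fun_prop) hopen
    (fun Δ z hz => (X.norm_levelTrace_mul_exp_le h g z Δ).trans
      (X.finrank_mul_exp_anti h Δ (le_of_lt hz)))
  exact (this.differentiableAt (hopen.mem_nhds (by simp; linarith))).differentiableWithinAt

/-- The partition function of the sector `h`, without the vacuum energy factor. -/
def sectorSum (h : G) (b : ℝ) : ℝ :=
  ∑' Δ : ℝ, (Module.finrank ℂ (X.level h Δ) : ℝ) * Real.exp (-b * Δ)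

/-- The contribution of the states of nonzero dimension to `sectorSum`. -/
def excitedSum (h : G) (b : ℝ) : ℝ :=
  ∑' Δ : ℝ, if Δ = 0 then 0 else (Module.finrank ℂ (X.level h Δ) : ℝ) * Real.exp (-b * Δ)

theorem summable_excited (h : G) {b : ℝ} (hb : 0 < b) : Summable fun Δ : ℝ =>
    if Δ = 0 then 0 else (Module.finrank ℂ (X.level h Δ) : ℝ) * Real.exp (-b * Δ) := by
  refine .of_nonneg_of_le (fun Δ => ?_) (fun Δ => ?_) (X.summable_level h b hb)
  · split_ifs <;> positivity
  · split_ifs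
    · positivity
    · exact le_rfl

theorem sectorSum_nonneg (h : G) (b : ℝ) : 0 ≤ X.sectorSum h b :=
  tsum_nonneg fun _ => by positivity

theorem sectorSum_anti (h : G) {b b' : ℝ} (hb : 0 < b) (hbb : b ≤ b') :
    X.sectorSum h b' ≤ X.sectorSum h b :=
  (X.summable_level h b' (hb.trans_le hbb)).tsum_le_tsum
    (fun Δ => X.finrank_mul_exp_anti h Δ hbb) (X.summable_level h b hb)

theorem norm_laplaceTrace_le (h g : G) {s : ℂ} (hs : 0 < s.re) :
    ‖X.laplaceTrace h g s‖ ≤ X.sectorSum h s.re :=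
  tsum_of_norm_bounded (X.summable_level h s.re hs).hasSum (X.norm_levelTrace_mul_exp_le h g s)

theorem levelTrace_one_right (h : G) (Δ : ℝ) :
    X.levelTrace h 1 Δ = Module.finrank ℂ (X.level h Δ) := by
  rw [levelTrace, ← LinearMap.trace_id]
  congr 1
  ext v
  simp

theorem laplaceTrace_one_right (h : G) (b : ℝ) : X.laplaceTrace h 1 b = X.sectorSum h b := by
  rw [laplaceTrace, sectorSum, Complex.ofReal_tsum]
  congr 1; ext Δ
  rw [levelTrace_one_right]; push_cast; rfl

/-- The level is spanned by the invariant vacuum. In particular the vacuum contribution is the same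
for every insertion `g`. -/
theorem levelTrace_vacuum (g : G) : X.levelTrace 1 g 0 = 1 := by
  have hlev : X.level 1 0 = Submodule.span ℂ {X.vac} := X.vac_unique
  have h1 : X.levelTrace 1 g 0 = X.levelTrace 1 1 0 := by
    rw [levelTrace, levelTrace]
    congr 1
    ext v
    obtain ⟨v, hv⟩ := v
    obtain ⟨r, rfl⟩ := Submodule.mem_span_singleton.1 (hlev ▸ hv)
    simp [X.ρ_vac]
  rw [h1, levelTrace_one_right, hlev, finrank_span_singleton X.vac_ne_zero, Nat.cast_one]

/-- Only the term of dimension zero is split off: it is the vacuum for the trivial twist and absent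
otherwise. -/
theorem norm_laplaceTrace_sub_le (hgap : ∀ g : G, g ≠ 1 → X.level g 0 = ⊥) [DecidableEq G]
    (h g : G) {s : ℂ} (hs : 0 < s.re) :
    ‖X.laplaceTrace h g s - if h = 1 then 1 else 0‖ ≤ X.excitedSum h s.re := by
  have h0 : X.levelTrace h g 0 = if h = 1 then 1 else 0 := by
    split_ifs with hh
    · rw [hh, levelTrace_vacuum]
    · exact X.levelTrace_eq_zero (hgap h hh) g
  have := (X.summable_levelTrace_mul_exp h g hs).tsum_eq_add_tsum_ite 0
  simp only [h0, Complex.ofReal_zero, mul_zero, Complex.exp_zero, mul_one] at this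
  rw [laplaceTrace, this, add_sub_cancel_left]
  refine tsum_of_norm_bounded (X.summable_excited h hs).hasSum fun Δ => ?_
  split_ifs
  · simp
  · exact X.norm_levelTrace_mul_exp_le h g s Δ

theorem finite_levels_le (h : G) (R : ℝ) : {Δ : ℝ | Δ ≤ R ∧ X.level h Δ ≠ ⊥}.Finite := by
  have hs := (X.summable_level h 1 one_pos).tendsto_cofinite_zero
  have hev := hs.eventually (gt_mem_nhds (Real.exp_pos (-1 * R)))
  rw [Filter.eventually_cofinite] at hev
  refine hev.subset ?_
  rintro Δ ⟨hΔ, hne⟩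
  simp only [Set.mem_ofPred_eq, not_lt]
  have h1 : (1 : ℝ) ≤ Module.finrank ℂ (X.level h Δ) := by
    have : Module.finrank ℂ (X.level h Δ) ≠ 0 := fun h0 => hne (Submodule.finrank_eq_zero.mp h0)
    exact_mod_cast Nat.one_le_iff_ne_zero.mpr this
  calc Real.exp (-1 * R) ≤ 1 * Real.exp (-1 * Δ) := by
        rw [one_mul]; exact Real.exp_le_exp.mpr (by linarith)
    _ ≤ _ := by gcongr; exact h1

/-- There is a gap above the vacuum. -/
theorem exists_gap [Finite G] :
    ∃ γ : ℝ, 0 < γ ∧ ∀ (h : G) (Δ : ℝ), Δ ≠ 0 → X.level h Δ ≠ ⊥ → γ ≤ Δ := by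
  -- Finitely many sectors, each with finitely many dimensions up to the arbitrary cutoff `1`; a
  -- finite set avoiding zero also avoids a neighbourhood of zero.
  let S : Set ℝ := (⋃ h : G, {Δ : ℝ | Δ ≤ 1 ∧ X.level h Δ ≠ ⊥}) \ {0}
  have hS : S.Finite := (Set.finite_iUnion fun h => X.finite_levels_le h 1).subset Set.sdiff_subset
  have h0 : Sᶜ ∈ nhds (0 : ℝ) := hS.isClosed.isOpen_compl.mem_nhds (by simp [S])
  obtain ⟨γ, hγ, hsub⟩ := Metric.mem_nhds_iff.1 h0
  refine ⟨min γ 1, by positivity, fun h Δ hΔ hne => ?_⟩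
  by_contra! hlt
  have hpos : 0 ≤ Δ := by
    by_contra! hneg
    exact hne (X.level_eq_bot_of_neg h hneg)
  refine hsub (a := Δ) ?_ ⟨Set.mem_iUnion.2 ⟨h, ?_, hne⟩, hΔ⟩
  · rw [Metric.mem_ball, Real.dist_eq, sub_zero, abs_of_nonneg hpos]
    exact hlt.trans_le (min_le_left _ _)
  · exact (hlt.trans_le (min_le_right _ _)).le

/-- Factor `e^{-bΔ} = e^{-(b-1)Δ} e^{-Δ}` and use `Δ ≥ γ` in the first factor; the second keeps the
sum convergent. -/
theorem excitedSum_le_of_gap {γ : ℝ}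
    (hγ : ∀ (h : G) (Δ : ℝ), Δ ≠ 0 → X.level h Δ ≠ ⊥ → γ ≤ Δ) (h : G) {b : ℝ} (hb : 1 ≤ b) :
    X.excitedSum h b ≤ Real.exp (-(b - 1) * γ) * X.sectorSum h 1 := by
  rw [sectorSum, ← tsum_mul_left]
  refine (X.summable_excited h (by linarith)).tsum_le_tsum (fun Δ => ?_)
    ((X.summable_level h 1 one_pos).mul_left _)
  split_ifs with h0
  · positivity
  by_cases hb0 : X.level h Δ = ⊥
  · rw [hb0, finrank_bot]; simp
  have := hγ h Δ h0 hb0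
  rw [mul_left_comm, ← Real.exp_add]
  gcongr
  nlinarith

/-- The function `b ↦ e^{b(a - Δ)}` is monotone, decreasing for heavy states `Δ ≥ a` and increasing
for light ones, so it is bounded by its value at `b₁` or at `b₂`. The two endpoints can then be
estimated by different means. -/
theorem exp_mul_excitedSum_le (h : G) {b₁ b b₂ a : ℝ} (h0 : 0 < b₁) (h1 : b₁ ≤ b) (h2 : b ≤ b₂) :
    Real.exp (b * a) * X.excitedSum h b
      ≤ Real.exp (b₁ * a) * X.sectorSum h b₁ + Real.exp (b₂ * a) * X.excitedSum h b₂ := by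
  rw [sectorSum, excitedSum, excitedSum, ← tsum_mul_left, ← tsum_mul_left, ← tsum_mul_left]
  have hs1 := (X.summable_level h b₁ h0).mul_left (Real.exp (b₁ * a))
  have hs2 := (X.summable_excited h (h0.trans_le (h1.trans h2))).mul_left (Real.exp (b₂ * a))
  have hs := (X.summable_excited h (h0.trans_le h1)).mul_left (Real.exp (b * a))
  refine (hs.tsum_le_tsum (fun Δ => ?_) (hs1.add hs2)).trans_eq (hs1.tsum_add hs2)
  split_ifs with hΔ
  · simp only [mul_zero, add_zero]; positivity
  have key : Real.exp (b * a + -b * Δ)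
      ≤ Real.exp (b₁ * a + -b₁ * Δ) + Real.exp (b₂ * a + -b₂ * Δ) := by
    rcases le_total a Δ with h | h
    · refine (Real.exp_le_exp.2 ?_).trans (le_add_of_nonneg_right (Real.exp_nonneg _))
      nlinarith
    · refine (Real.exp_le_exp.2 ?_).trans (le_add_of_nonneg_left (Real.exp_nonneg _))
      nlinarith
  simp only [Real.exp_add] at key
  have hn : (0 : ℝ) ≤ Module.finrank ℂ (X.level h Δ) := by positivity
  change _ ≤ Real.exp (b₁ * a) * ((Module.finrank ℂ (X.level h Δ) : ℝ) * Real.exp (-b₁ * Δ)) + _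
  nlinarith [mul_le_mul_of_nonneg_left key hn]

end SymmetricStateSpace

/-! ### Modular covariance and the bound on the Laplace transform -/

namespace SymmetricCFT

variable {G V : Type*} [Group G] [NormedAddCommGroup V] [InnerProductSpace ℂ V]
  (X : SymmetricCFT G V)

/-- Modular covariance at complex inverse temperature. -/
theorem laplaceTrace_S (h g : G) {s : ℂ} (hs : 0 < s.re) :
    Complex.exp (s * (X.c / 12)) * X.laplaceTrace h g s
      = Complex.exp (4 * Real.pi ^ 2 / s * (X.c / 12))
        * X.laplaceTrace g h⁻¹ (4 * Real.pi ^ 2 / s) := by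
  let U : Set ℂ := {s | 0 < s.re}
  have hU : IsOpen U := isOpen_lt continuous_const Complex.continuous_re
  have hne : ∀ z ∈ U, z ≠ 0 := fun z hz h0 => by simp [U, h0] at hz
  have hinv : DifferentiableOn ℂ (fun z : ℂ => 4 * (Real.pi : ℂ) ^ 2 / z) U :=
    DifferentiableOn.div (by fun_prop) (by fun_prop) hne
  have hmaps : Set.MapsTo (fun z : ℂ => 4 * (Real.pi : ℂ) ^ 2 / z) U U := by
    intro z hz
    have : 4 * (Real.pi : ℂ) ^ 2 / z = ((4 * Real.pi ^ 2 : ℝ) : ℂ) * z⁻¹ := by push_cast; rfl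
    simp only [U, Set.mem_ofPred_eq, this, Complex.re_ofReal_mul, Complex.inv_re]
    have : 0 < Complex.normSq z := Complex.normSq_pos.2 (hne z hz)
    have : 0 < z.re := hz
    positivity
  have hf : DifferentiableOn ℂ
      (fun z => Complex.exp (z * (X.c / 12)) * X.laplaceTrace h g z) U :=
    DifferentiableOn.mul (by fun_prop) (X.differentiableOn_laplaceTrace h g)
  have hg : DifferentiableOn ℂ (fun z => Complex.exp (4 * Real.pi ^ 2 / z * (X.c / 12))
      * X.laplaceTrace g h⁻¹ (4 * Real.pi ^ 2 / z)) U :=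
    DifferentiableOn.mul (hinv.mul_const _).cexp
      ((X.differentiableOn_laplaceTrace g h⁻¹).comp hinv hmaps)
  refine (hf.analyticOnNhd hU).eqOn_of_preconnected_of_frequently_eq (hg.analyticOnNhd hU)
    (convex_halfSpace_re_gt 0).isPreconnected (z₀ := 1)
    (show (0 : ℝ) < (1 : ℂ).re by simp) ?_ hs
  -- Covariance is assumed for real temperatures only; the real points to the right of `1`
  -- accumulate at `1`, which is all the identity theorem needs.
  have htend : Tendsto (fun x : ℝ => (x : ℂ)) (nhdsWithin 1 (Set.Ioi 1)) (nhdsWithin 1 {1}ᶜ) := by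
    refine tendsto_nhdsWithin_iff.2 ⟨?_, ?_⟩
    · exact (Complex.continuous_ofReal.tendsto' 1 1 Complex.ofReal_one).mono_left
        nhdsWithin_le_nhds
    · filter_upwards [self_mem_nhdsWithin] with x hx
      have : (x : ℂ) ≠ 1 := by exact_mod_cast (ne_of_gt hx)
      exact this
  refine htend.frequently (Eventually.frequently ?_)
  filter_upwards [self_mem_nhdsWithin] with x hx
  have hx : 0 < x := lt_trans one_pos hx
  have := X.S_covariant x hx h g
  rw [SymmetricStateSpace.Z_eq, SymmetricStateSpace.Z_eq] at this
  push_cast at this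
  exact this

/-- Apply `S` with the trivial insertion: every sector becomes the untwisted one with `h⁻¹`
inserted, at a dual inverse temperature at least `1`, where the trace is bounded by a constant. -/
theorem exp_mul_sectorSum_le (h : G) {b : ℝ} (hb : 0 < b) (hb' : b ≤ 4 * Real.pi ^ 2) :
    Real.exp (b * (X.c / 12)) * X.sectorSum h b
      ≤ Real.exp (4 * Real.pi ^ 2 / b * (X.c / 12)) * X.sectorSum 1 1 := by
  have h1 := congrArg norm (X.laplaceTrace_S h 1 (s := b) (by simpa using hb))
  have e1 : (b : ℂ) * (X.c / 12) = ((b * (X.c / 12) : ℝ) : ℂ) := by push_cast; rfl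
  have e2 : (4 * Real.pi ^ 2 / b : ℂ) = ((4 * Real.pi ^ 2 / b : ℝ) : ℂ) := by push_cast; rfl
  have e3 : (((4 * Real.pi ^ 2 / b : ℝ) : ℂ)) * (X.c / 12)
      = ((4 * Real.pi ^ 2 / b * (X.c / 12) : ℝ) : ℂ) := by push_cast; rfl
  have hge : 1 ≤ 4 * Real.pi ^ 2 / b := by rwa [le_div_iff₀ hb, one_mul]
  rw [norm_mul, norm_mul, e1, e2, e3, ← Complex.ofReal_exp, ← Complex.ofReal_exp,
    X.laplaceTrace_one_right, Complex.norm_real, Complex.norm_real, Complex.norm_real,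
    Real.norm_of_nonneg (Real.exp_nonneg _), Real.norm_of_nonneg (X.sectorSum_nonneg h b),
    Real.norm_of_nonneg (Real.exp_nonneg _)] at h1
  rw [h1]
  gcongr
  refine (X.norm_laplaceTrace_le 1 h⁻¹ (s := ((4 * Real.pi ^ 2 / b : ℝ) : ℂ)) ?_).trans ?_
  · rw [Complex.ofReal_re]; positivity
  · rw [Complex.ofReal_re]; exact X.sectorSum_anti 1 one_pos hge

/-- In the dual channel, the deviation of a twisted partition function from the vacuum contribution
is exponentially small relative to the latter, uniformly in a vertical segment. -/
theorem norm_laplaceTrace_S_sub_le [DecidableEq G]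
    (hc : 0 < X.c) (hgap : ∀ g : G, g ≠ 1 → X.level g 0 = ⊥) {γ : ℝ}
    (hγ : ∀ (h : G) (Δ : ℝ), Δ ≠ 0 → X.level h Δ ≠ ⊥ → γ ≤ Δ) {Λ : ℝ} (hΛ : 0 < Λ) (h g : G) {β τ : ℝ}
    (hβ : 0 < β) (hβ1 : β ≤ 1) (hβΛ : β ≤ 4 * Real.pi ^ 2 * Λ)
    (hτ : β ^ 2 + τ ^ 2 ≤ 4 * Real.pi ^ 2 * Λ) :
    ‖X.laplaceTrace h g ⟨β, τ⟩ - Complex.exp (-⟨β, τ⟩ * (X.c / 12))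
        * ((if g = 1 then 1 else 0) * Complex.exp (4 * Real.pi ^ 2 / ⟨β, τ⟩ * (X.c / 12)))‖
      ≤ Real.exp (Λ * (Real.pi ^ 2 * X.c / 3 / β)) * X.sectorSum 1 1
        + Real.exp ((1 - 12 * γ / X.c) * (Real.pi ^ 2 * X.c / 3 / β))
          * (Real.exp γ * X.sectorSum g 1) := by
  have hs : 0 < (⟨β, τ⟩ : ℂ).re := hβ
  set s : ℂ := ⟨β, τ⟩ with hsdef
  set w : ℂ := 4 * Real.pi ^ 2 / s with hw
  have hnsq : Complex.normSq s = β ^ 2 + τ ^ 2 := by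
    simp only [hsdef, Complex.normSq_mk]; ring
  have hnpos : 0 < β ^ 2 + τ ^ 2 := by positivity
  have hwre : w.re = 4 * Real.pi ^ 2 * β / (β ^ 2 + τ ^ 2) := by
    have : w = ((4 * Real.pi ^ 2 : ℝ) : ℂ) * s⁻¹ := by rw [hw]; push_cast; rfl
    rw [this, Complex.re_ofReal_mul, Complex.inv_re, hnsq, mul_div_assoc]
  have hpi : 0 < Real.pi := Real.pi_pos
  -- This is where the bound on `|s|²` enters; the upper bound `hw2` is attained at `τ = 0`.
  have hw1 : β / Λ ≤ w.re := by
    rw [hwre, div_le_div_iff₀ hΛ hnpos]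
    nlinarith
  have hw2 : w.re ≤ 4 * Real.pi ^ 2 / β := by
    rw [hwre, div_le_div_iff₀ hnpos hβ]
    nlinarith [mul_nonneg (sq_nonneg Real.pi) (sq_nonneg τ)]
  have hwpos : 0 < w.re := lt_of_lt_of_le (by positivity) hw1
  have h1 : X.laplaceTrace h g s
      = Complex.exp (-s * (X.c / 12)) * (Complex.exp (w * (X.c / 12)) * X.laplaceTrace g h⁻¹ w) := by
    rw [← X.laplaceTrace_S h g hs, ← mul_assoc, ← Complex.exp_add, neg_mul, neg_add_cancel,
      Complex.exp_zero, one_mul]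
  have hnorm : ∀ z : ℂ, ‖Complex.exp (z * (X.c / 12))‖ = Real.exp (z.re * (X.c / 12)) := by
    intro z
    rw [Complex.norm_exp]
    congr 1
    rw [show (z * (X.c / 12) : ℂ) = z * ((X.c / 12 : ℝ) : ℂ) by push_cast; rfl, Complex.re_mul_ofReal]
  rw [h1, mul_comm (ite _ _ _), ← mul_sub, ← mul_sub, norm_mul, norm_mul, hnorm, hnorm]
  have hle1 : Real.exp ((-s).re * (X.c / 12)) ≤ 1 := by
    rw [Real.exp_le_one_iff, Complex.neg_re]
    nlinarith
  have hge : 1 ≤ 4 * Real.pi ^ 2 / β := by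
    rw [le_div_iff₀ hβ]; nlinarith [Real.pi_gt_three]
  calc _ ≤ 1 * (Real.exp (w.re * (X.c / 12)) * X.excitedSum g w.re) := by
        gcongr
        exact X.norm_laplaceTrace_sub_le hgap g h⁻¹ hwpos
    _ ≤ Real.exp (β / Λ * (X.c / 12)) * X.sectorSum g (β / Λ)
        + Real.exp (4 * Real.pi ^ 2 / β * (X.c / 12)) * X.excitedSum g (4 * Real.pi ^ 2 / β) := by
        rw [one_mul]
        exact X.exp_mul_excitedSum_le g (by positivity) hw1 hw2
    -- The endpoint `β / Λ` is sent back by a second modular transformation, producing the rate `Λ`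
    -- in place of `1`; at the other endpoint the gap lowers the rate by `12γ / c`.
    _ ≤ Real.exp (4 * Real.pi ^ 2 / (β / Λ) * (X.c / 12)) * X.sectorSum 1 1
        + Real.exp (4 * Real.pi ^ 2 / β * (X.c / 12))
          * (Real.exp (-(4 * Real.pi ^ 2 / β - 1) * γ) * X.sectorSum g 1) := by
        refine add_le_add (X.exp_mul_sectorSum_le g (by positivity) (by rwa [div_le_iff₀ hΛ])) ?_
        exact mul_le_mul_of_nonneg_left (X.excitedSum_le_of_gap hγ g hge) (Real.exp_nonneg _)
    _ = _ := by
        have e1 : 4 * Real.pi ^ 2 / (β / Λ) * (X.c / 12) = Λ * (Real.pi ^ 2 * X.c / 3 / β) := by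
          field_simp; ring
        have e2 : 4 * Real.pi ^ 2 / β * (X.c / 12) + -(4 * Real.pi ^ 2 / β - 1) * γ
            = (1 - 12 * γ / X.c) * (Real.pi ^ 2 * X.c / 3 / β) + γ := by
          field_simp; ring
        rw [← mul_assoc (Real.exp _) (Real.exp _), ← mul_assoc (Real.exp _) (Real.exp _),
          ← Real.exp_add, ← Real.exp_add, e1, e2]

/-- The Laplace transform of the density of states of an irrep is governed by the vacuum in the dual
channel, uniformly in every vertical segment of half-height less than `2π`. -/
theorem exists_laplace_bound [Fintype G] {W : Type*} [AddCommGroup W] [Module ℂ W]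
    [FiniteDimensional ℂ W] (hc : 0 < X.c) (hgap : ∀ g : G, g ≠ 1 → X.level g 0 = ⊥)
    (g₀ : G) (α : Representation ℂ G W) {Λ : ℝ} (hΛ : 0 < Λ) (hΛ1 : Λ < 1) :
    ∃ θ < 1, ∃ C : ℝ, ∃ β₀ > 0, ∀ β τ : ℝ, 0 < β → β ≤ β₀ → |τ| ≤ 2 * Real.pi * Λ →
      ‖(∑' x : ℝ, (X.irrepCount α g₀ x : ℂ) * Complex.exp (-⟨β, τ⟩ * x))
          - ((Module.finrank ℂ W : ℝ) ^ 2 / (Fintype.card G : ℝ) : ℝ)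
            * Complex.exp (-⟨β, τ⟩ * (X.c / 12))
            * Complex.exp ((Real.pi ^ 2 * X.c / 3 : ℝ) / ⟨β, τ⟩)‖
        ≤ C * Real.exp (θ * (Real.pi ^ 2 * X.c / 3 / β)) := by
  classical
  obtain ⟨γ, hγ0, hγ⟩ := X.exists_gap
  have hpi : 0 < Real.pi := Real.pi_pos
  let D : ℝ := (Module.finrank ℂ W : ℝ) / Fintype.card G
  have hD : 0 ≤ D := by positivity
  -- The exponent is the worse of the heavy and light rates. The square root in the last entry of
  -- `β₀` comes from requiring `β² + (2πΛ)² ≤ 4π²Λ`.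
  refine ⟨max Λ (1 - 12 * γ / X.c), max_lt hΛ1 (by have : 0 < 12 * γ / X.c := by positivity
                                                   linarith),
    D * ∑ g : G, (X.sectorSum 1 1 + Real.exp γ * X.sectorSum g 1) * ‖α.character g‖,
    min (min 1 (4 * Real.pi ^ 2 * Λ)) (2 * Real.pi * Real.sqrt (Λ * (1 - Λ))), ?_, ?_⟩
  · have : 0 < Λ * (1 - Λ) := mul_pos hΛ (by linarith)
    positivity
  intro β τ hβ hβ0 hτ
  have hb1 : β ≤ 1 := hβ0.trans ((min_le_left _ _).trans (min_le_left _ _))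
  have hb2 : β ≤ 4 * Real.pi ^ 2 * Λ := hβ0.trans ((min_le_left _ _).trans (min_le_right _ _))
  have hb3 : β ≤ 2 * Real.pi * Real.sqrt (Λ * (1 - Λ)) := hβ0.trans (min_le_right _ _)
  have hτ2 : β ^ 2 + τ ^ 2 ≤ 4 * Real.pi ^ 2 * Λ := by
    have e1 : β ^ 2 ≤ (2 * Real.pi * Real.sqrt (Λ * (1 - Λ))) ^ 2 := by gcongr
    have e2 : τ ^ 2 ≤ (2 * Real.pi * Λ) ^ 2 := by
      rw [← sq_abs]; gcongr
    rw [mul_pow, Real.sq_sqrt (mul_nonneg hΛ.le (by linarith))] at e1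
    nlinarith
  set s : ℂ := ⟨β, τ⟩ with hs
  have hsre : 0 < s.re := hβ
  have hsne : s ≠ 0 := fun h => by simp [h] at hsre
  rw [(X.hasSum_irrepCount_mul_exp α g₀ hsre).tsum_eq]
  -- Only `g = 1` survives in the sum, and its character value supplies the second factor of the
  -- dimension.
  have hmain : ((Module.finrank ℂ W : ℝ) ^ 2 / (Fintype.card G : ℝ) : ℝ)
      * Complex.exp (-s * (X.c / 12)) * Complex.exp ((Real.pi ^ 2 * X.c / 3 : ℝ) / s)
      = (D : ℂ) * ∑ g : G, Complex.exp (-s * (X.c / 12))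
        * ((if g = 1 then 1 else 0) * Complex.exp (4 * Real.pi ^ 2 / s * (X.c / 12)))
        * (starRingEnd ℂ) (α.character g) := by
    have e : (4 * Real.pi ^ 2 / s * (X.c / 12) : ℂ) = (Real.pi ^ 2 * X.c / 3 : ℝ) / s := by
      push_cast; field_simp; ring
    rw [e]
    simp only [mul_ite, ite_mul, zero_mul, one_mul, mul_zero, Finset.sum_ite_eq', Finset.mem_univ,
      if_true, Representation.char_one, map_natCast, D]
    push_cast
    ring
  have hDc : ((Module.finrank ℂ W : ℂ) / (Fintype.card G : ℂ)) = (D : ℂ) := by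
    simp [D]
  rw [hmain, hDc, ← mul_sub, ← Finset.sum_sub_distrib, norm_mul, Complex.norm_real,
    Real.norm_of_nonneg hD, mul_assoc D, Finset.sum_mul]
  gcongr
  refine (norm_sum_le _ _).trans (Finset.sum_le_sum fun g _ => ?_)
  rw [← sub_mul, norm_mul, RCLike.norm_conj, mul_right_comm]
  gcongr
  refine (X.norm_laplaceTrace_S_sub_le hc hgap hγ hΛ g₀ g hβ hb1 hb2 hτ2).trans ?_
  have hA : 0 ≤ Real.pi ^ 2 * X.c / 3 / β := by positivity
  have hn := X.sectorSum_nonneg 1 1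
  have hn' := X.sectorSum_nonneg g 1
  rw [add_mul, mul_comm (X.sectorSum 1 1), mul_comm (_ * _ : ℝ) (Real.exp (_ * (_ / β)))]
  gcongr
  · exact le_max_left _ _
  · exact le_max_right _ _

end SymmetricCFT

end

/-! ### Beurling-Selberg majorants and minorants of an interval -/

noncomputable section

open MeasureTheory Real Set

/-- The Fejér kernel is the Fourier transform of the triangle function; in this form it is visibly
band-limited. -/
theorem two_mul_integral_one_sub_mul_cos (x : ℝ) :
    2 * ∫ t in (0 : ℝ)..1, (1 - t) * cos (2 * π * x * t) = sinc (π * x) ^ 2 := by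
  rcases eq_or_ne x 0 with rfl | hx
  · have h : ∫ t in (0 : ℝ)..1, (1 - t) = 1 / 2 := by
      rw [intervalIntegral.integral_sub (by simp) (by simp)]
      norm_num
    simp [h]
  have hω : 2 * π * x ≠ 0 := by positivity
  have hderiv : ∀ t ∈ uIcc (0 : ℝ) 1, HasDerivAt
      (fun t => (1 - t) * (sin (2 * π * x * t) / (2 * π * x))
        - cos (2 * π * x * t) / (2 * π * x) ^ 2) ((1 - t) * cos (2 * π * x * t)) t := by
    intro t _
    have h0 : HasDerivAt (fun t : ℝ => 2 * π * x * t) (2 * π * x) t := by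
      simpa using (hasDerivAt_id t).const_mul (2 * π * x)
    have h1 : HasDerivAt (fun t : ℝ => 1 - t) (-1) t := by
      simpa using (hasDerivAt_id t).const_sub 1
    have := (h1.mul (h0.sin.div_const (2 * π * x))).sub (h0.cos.div_const ((2 * π * x) ^ 2))
    convert! this using 1
    field_simp
    ring
  rw [intervalIntegral.integral_eq_sub_of_hasDerivAt hderiv
    (by apply Continuous.intervalIntegrable; fun_prop), sinc_of_ne_zero (by positivity)]
  simp only [mul_one, mul_zero, sub_self, zero_mul, sin_zero, cos_zero, sub_zero, zero_div]
  have : cos (2 * π * x) = 1 - 2 * sin (π * x) ^ 2 := by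
    rw [mul_assoc, cos_two_mul, ← sin_sq_add_cos_sq (π * x)]; ring
  rw [this]
  field_simp
  ring

theorem integral_sin_two_pi_mul (y : ℝ) :
    ∫ t in (0 : ℝ)..1, sin (2 * π * y * t) = sin (π * y) ^ 2 / (π * y) := by
  rcases eq_or_ne y 0 with rfl | hy
  · simp
  rw [intervalIntegral.integral_comp_mul_left (fun t => sin t) (by positivity), integral_sin]
  have : cos (2 * π * y) = 1 - 2 * sin (π * y) ^ 2 := by
    rw [mul_assoc, cos_two_mul, ← sin_sq_add_cos_sq (π * y)]; ring
  simp only [mul_zero, cos_zero, mul_one, this, smul_eq_mul]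
  field_simp
  ring

/-- The integer translates of the Fejér kernel form a partition of unity. -/
theorem hasSum_sinc_sq (y : ℝ) : HasSum (fun n : ℤ => sinc (π * (y - n)) ^ 2) 1 := by
  -- Parseval on the unit interval: `f` has modulus one, and the moduli of its Fourier coefficients
  -- are `|sinc(π(y - n))|`.
  let f : ℝ → ℂ := fun t => Complex.exp ((2 * π * y : ℝ) * Complex.I * t)
  have hf : ∀ t, ‖f t‖ = 1 := fun t => by
    simp only [f]
    rw [mul_right_comm, ← Complex.ofReal_mul, Complex.norm_exp_ofReal_mul_I]
  have hmem : MemLp f 2 (volume.restrict (Ioc (0 : ℝ) 1)) :=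
    MemLp.of_bound (by apply Continuous.aestronglyMeasurable; fun_prop) 1
      (Eventually.of_forall fun t => (hf t).le)
  have := hasSum_sq_fourierCoeffOn (zero_lt_one (α := ℝ)) hmem
  simp only [hf, one_pow, intervalIntegral.integral_const, sub_zero, inv_one, smul_eq_mul,
    mul_one] at this
  convert! this using 2 with n
  rw [fourierCoeffOn_eq_integral]
  have hint : ∀ t : ℝ, (fourier (-n) : AddCircle ((1 : ℝ) - 0) → ℂ) (t : AddCircle ((1 : ℝ) - 0)) • f t
      = Complex.exp ((2 * π * (y - n) : ℝ) * Complex.I * t) := by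
    intro t
    rw [fourier_coe_apply, smul_eq_mul, ← Complex.exp_add]
    congr 1; push_cast; ring
  simp only [hint, sub_zero, div_one, one_smul]
  rcases eq_or_ne (y - n) 0 with h | h
  · simp [h]
  have hc : ((2 * π * (y - n) : ℝ) : ℂ) * Complex.I ≠ 0 := by
    refine mul_ne_zero ?_ Complex.I_ne_zero
    exact_mod_cast (by positivity)
  rw [integral_exp_mul_complex hc, sinc_of_ne_zero (by positivity)]
  simp only [Complex.ofReal_one, mul_one, Complex.ofReal_zero, mul_zero, Complex.exp_zero]
  have hI : ∀ a : ℝ, ‖Complex.I * (a : ℂ)‖ = ‖a‖ := fun a => by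
    rw [norm_mul, Complex.norm_I, one_mul, Complex.norm_real]
  rw [norm_div, mul_comm _ Complex.I, Complex.norm_exp_I_mul_ofReal_sub_one, hI, ← norm_div,
    norm_eq_abs, sq_abs]
  rw [show 2 * π * (y - n) / 2 = π * (y - n) by ring]
  congr 1
  field_simp

theorem tendsto_sinc_sq_partition (y : ℝ) :
    Tendsto (fun N : ℕ => sinc (π * y) ^ 2
      + ∑ n ∈ Finset.range N, (sinc (π * (y - (n + 1))) ^ 2 + sinc (π * (y + (n + 1))) ^ 2))
      atTop (nhds 1) := by
  have h := (hasSum_sinc_sq y).nat_add_neg.tendsto_sum_nat.comp (tendsto_add_atTop_nat 1)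
  have h' := h.sub_const (sinc (π * y) ^ 2)
  simp only [Int.cast_zero, sub_zero, add_sub_cancel_right] at h'
  refine h'.congr fun N => ?_
  simp only [Function.comp_apply, Finset.sum_range_succ']
  push_cast
  simp only [sub_neg_eq_add, neg_zero, sub_zero]
  ring

/-- Partial sums of twice Beurling's approximation to the sign function. -/
def signApprox (N : ℕ) (y : ℝ) : ℝ :=
  ∑ n ∈ Finset.range N, (sinc (π * (y - (n + 1))) ^ 2 - sinc (π * (y + (n + 1))) ^ 2)
    + 2 / π * (sin (π * y) ^ 2 / (π * y))

theorem signApprox_neg (N : ℕ) (y : ℝ) : signApprox N (-y) = -signApprox N y := by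
  have h : ∀ a : ℝ, sinc (π * (-y - a)) = sinc (π * (y + a)) := fun a => by
    rw [← sinc_neg]; congr 1; ring
  have h' : ∀ a : ℝ, sinc (π * (-y + a)) = sinc (π * (y - a)) := fun a => by
    rw [← sinc_neg]; congr 1; ring
  simp only [signApprox, h, h', mul_neg, sin_neg, neg_sq, div_neg, neg_add, ← Finset.sum_neg_distrib,
    neg_sub]

theorem sinc_sq_add_nat {y : ℝ} (hy : 0 < y) (n : ℕ) :
    sinc (π * (y + n)) ^ 2 = sin (π * y) ^ 2 / π ^ 2 * (1 / (y + n) ^ 2) := by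
  have hpos : 0 < y + n := by positivity
  rw [sinc_of_ne_zero (by positivity)]
  have : sin (π * (y + n)) ^ 2 = sin (π * y) ^ 2 := by
    rw [mul_add, mul_comm π (n : ℝ), sin_add_nat_mul_pi, mul_pow, ← pow_mul, mul_comm n 2, pow_mul]
    simp
  rw [div_pow, this, mul_pow]
  field_simp

/-- Here and in `le_sum_inv_sq` the telescoping comparison is `1/(y+n+1)² ≤ 1/(y+n) - 1/(y+n+1) ≤
1/(y+n)²`. Starting at `n = 1` or at `n = 0` places the sum below or above the correction term of
`signApprox`. -/
theorem sum_inv_sq_le {y : ℝ} (hy : 0 < y) (N : ℕ) :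
    ∑ n ∈ Finset.range N, 1 / (y + (n + 1 : ℕ)) ^ 2 ≤ 1 / y - 1 / (y + N) := by
  induction N with
  | zero => simp
  | succ N ih =>
    rw [Finset.sum_range_succ]
    have h0 : 0 < y + N := by positivity
    have : 1 / (y + (N + 1 : ℕ)) ^ 2 ≤ 1 / (y + N) - 1 / (y + (N + 1 : ℕ)) := by
      push_cast
      rw [div_sub_div _ _ (by positivity) (by positivity), div_le_div_iff₀ (by positivity) (by positivity)]
      nlinarith
    linarith

theorem le_sum_inv_sq {y : ℝ} (hy : 0 < y) (N : ℕ) :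
    1 / y - 1 / (y + N) ≤ ∑ n ∈ Finset.range N, 1 / (y + n) ^ 2 := by
  induction N with
  | zero => simp
  | succ N ih =>
    rw [Finset.sum_range_succ]
    have h0 : 0 < y + N := by positivity
    have : 1 / (y + N) - 1 / (y + (N + 1 : ℕ)) ≤ 1 / (y + N) ^ 2 := by
      push_cast
      rw [div_sub_div _ _ (by positivity) (by positivity), div_le_div_iff₀ (by positivity) (by positivity)]
      nlinarith
    linarith

/-- The right side minus the left is `2 sin²(πy)/π²` times `1/y - ∑ 1/(y+n)²` over `1 ≤ n ≤ N`,
which is nonnegative. -/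
theorem partition_le_signApprox_add {y : ℝ} (hy : 0 < y) (N : ℕ) :
    sinc (π * y) ^ 2
      + ∑ n ∈ Finset.range N, (sinc (π * (y - (n + 1))) ^ 2 + sinc (π * (y + (n + 1))) ^ 2)
      ≤ signApprox N y + sinc (π * y) ^ 2 := by
  have h : ∑ n ∈ Finset.range N, sinc (π * (y + (n + 1))) ^ 2
      ≤ sin (π * y) ^ 2 / π ^ 2 * (1 / y) := by
    calc _ = sin (π * y) ^ 2 / π ^ 2 * ∑ n ∈ Finset.range N, 1 / (y + (n + 1 : ℕ)) ^ 2 := by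
          rw [Finset.mul_sum]
          refine Finset.sum_congr rfl fun n _ => ?_
          rw [← sinc_sq_add_nat hy]; push_cast; rfl
      _ ≤ _ := by
          gcongr
          refine (sum_inv_sq_le hy N).trans ?_
          have : 0 ≤ 1 / (y + N) := by positivity
          linarith
  have e : 2 / π * (sin (π * y) ^ 2 / (π * y)) = 2 * (sin (π * y) ^ 2 / π ^ 2 * (1 / y)) := by
    field_simp
  rw [signApprox, Finset.sum_add_distrib, Finset.sum_sub_distrib, e]
  linarith

/-- The same comparison, now with the term `n = 0` included; the finite sum misses `1/y` by at most
`1/(y+N+1)`, which is the error term. -/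
theorem signApprox_sub_le_partition {y : ℝ} (hy : 0 < y) (N : ℕ) :
    signApprox N y - sinc (π * y) ^ 2 ≤ sinc (π * y) ^ 2
      + ∑ n ∈ Finset.range N, (sinc (π * (y - (n + 1))) ^ 2 + sinc (π * (y + (n + 1))) ^ 2)
      + 2 / π ^ 2 * (1 / (y + (N + 1 : ℕ))) := by
  have h : sin (π * y) ^ 2 / π ^ 2 * (1 / y - 1 / (y + (N + 1 : ℕ)))
      ≤ ∑ n ∈ Finset.range N, sinc (π * (y + (n + 1))) ^ 2 + sinc (π * y) ^ 2 := by
    calc _ ≤ sin (π * y) ^ 2 / π ^ 2 * ∑ n ∈ Finset.range (N + 1), 1 / (y + n) ^ 2 := by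
          gcongr
          exact le_sum_inv_sq hy (N + 1)
      _ = _ := by
          rw [Finset.mul_sum, Finset.sum_range_succ']
          congr 1
          · refine Finset.sum_congr rfl fun n _ => ?_
            rw [← sinc_sq_add_nat hy]; push_cast; rfl
          · rw [← sinc_sq_add_nat hy]; simp
  have e : 2 / π * (sin (π * y) ^ 2 / (π * y)) = 2 * (sin (π * y) ^ 2 / π ^ 2 * (1 / y)) := by
    field_simp
  have h2 : sin (π * y) ^ 2 / π ^ 2 * (1 / (y + (N + 1 : ℕ))) ≤ 1 / π ^ 2 * (1 / (y + (N + 1 : ℕ))) := by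
    gcongr
    exact sin_sq_le_one _
  have e2 : 2 / π ^ 2 * (1 / (y + (N + 1 : ℕ))) = 2 * (1 / π ^ 2 * (1 / (y + (N + 1 : ℕ)))) := by ring
  rw [signApprox, Finset.sum_add_distrib, Finset.sum_sub_distrib, e, e2]
  rw [mul_sub] at h
  linarith

/-- Asymptotically, `signApprox N + sinc²` is at least `1` on `[0, ∞)` and at least `-1` everywhere,
and `signApprox N - sinc²` is at most `-1` on `(-∞, 0]` and at most `1` everywhere. -/
theorem exists_signApprox_bounds (y : ℝ) : ∃ e : ℕ → ℝ, Tendsto e atTop (nhds 0) ∧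
    (0 ≤ y → ∀ N, 1 - e N ≤ signApprox N y + sinc (π * y) ^ 2) ∧
    (∀ N, -1 - e N ≤ signApprox N y + sinc (π * y) ^ 2) ∧
    (y ≤ 0 → ∀ N, signApprox N y - sinc (π * y) ^ 2 ≤ -1 + e N) ∧
    (∀ N, signApprox N y - sinc (π * y) ^ 2 ≤ 1 + e N) := by
  have pos : ∀ y : ℝ, 0 < y → ∃ e : ℕ → ℝ, Tendsto e atTop (nhds 0) ∧ (∀ N, 0 ≤ e N) ∧
      (∀ N, 1 - e N ≤ signApprox N y + sinc (π * y) ^ 2) ∧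
      (∀ N, signApprox N y - sinc (π * y) ^ 2 ≤ 1 + e N) := by
    intro y hy
    let P : ℕ → ℝ := fun N => sinc (π * y) ^ 2
      + ∑ n ∈ Finset.range N, (sinc (π * (y - (n + 1))) ^ 2 + sinc (π * (y + (n + 1))) ^ 2)
    have hP : Tendsto P atTop (nhds 1) := tendsto_sinc_sq_partition y
    have h1 : Tendsto (fun N => |P N - 1|) atTop (nhds 0) := by
      have := (hP.sub_const 1).abs; simpa using this
    have h2 : Tendsto (fun N : ℕ => 2 / π ^ 2 * (1 / (y + (N + 1 : ℕ)))) atTop (nhds 0) := by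
      have h3 : Tendsto (fun N : ℕ => y + ((N + 1 : ℕ) : ℝ)) atTop atTop :=
        tendsto_atTop_add_const_left _ _
          (tendsto_natCast_atTop_atTop.comp (tendsto_add_atTop_nat 1))
      have := (tendsto_inv_atTop_zero.comp h3).const_mul (2 / π ^ 2)
      simpa [Function.comp_def] using this
    have hnn : ∀ N : ℕ, 0 ≤ 2 / π ^ 2 * (1 / (y + (N + 1 : ℕ))) := fun N => by positivity
    refine ⟨fun N => |P N - 1| + 2 / π ^ 2 * (1 / (y + (N + 1 : ℕ))), by simpa using h1.add h2,
      fun N => add_nonneg (abs_nonneg _) (hnn N), fun N => ?_, fun N => ?_⟩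
    · have h4 : P N ≤ _ := partition_le_signApprox_add hy N
      have := neg_abs_le (P N - 1)
      have := hnn N
      linarith
    · have h4 : _ ≤ P N + _ := signApprox_sub_le_partition hy N
      have := le_abs_self (P N - 1)
      linarith
  -- For negative `y` oddness exchanges the majorant and minorant bounds. At zero the approximation
  -- vanishes and `sinc² = 1`, so all bounds hold without error.
  rcases lt_trichotomy y 0 with hy | rfl | hy
  · obtain ⟨e, he, hn, h1, h2⟩ := pos (-y) (by linarith)
    simp only [signApprox_neg, mul_neg, sinc_neg] at h1 h2
    refine ⟨e, he, fun h => absurd h (not_le.2 hy), fun N => ?_, fun _ N => ?_, fun N => ?_⟩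
    · linarith [h2 N]
    · linarith [h1 N]
    · linarith [h1 N, hn N]
  · refine ⟨0, tendsto_const_nhds, ?_⟩
    have h0 : ∀ N, signApprox N 0 = 0 := fun N => by
      have := signApprox_neg N 0
      rw [neg_zero] at this; linarith
    simp [h0]
  · obtain ⟨e, he, hn, h1, h2⟩ := pos y hy
    exact ⟨e, he, fun _ => h1, fun N => by linarith [h1 N, hn N],
      fun h => absurd h (not_le.2 hy), h2⟩

/-- The quotient `(1 - t) sin(2πrt) / sin(πt)`, which is bounded on `(0, 1)`. -/
def sinQuotient (r t : ℝ) : ℝ := (1 - t) * sin (2 * π * r * t) / sin (π * t)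

/-- The Fourier transform of Selberg's majorant (`σ = 1`) and minorant (`σ = -1`) of `[-r, r]`. -/
def selbergDensity (r σ t : ℝ) : ℝ :=
  sinQuotient r t * cos (π * t) + sin (2 * π * r * t) / π + σ * ((1 - t) * cos (2 * π * r * t))

theorem measurable_sinQuotient (r : ℝ) : Measurable (sinQuotient r) := by
  unfold sinQuotient; fun_prop

theorem measurable_selbergDensity (r σ : ℝ) : Measurable (selbergDensity r σ) := by
  have := measurable_sinQuotient r
  unfold selbergDensity; fun_prop

/-- Jordan's inequality on each half of the interval gives `sin(πt) ≥ 2t(1-t)`: the zero of the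
denominator at `0` is compensated by `sin(2πrt)`, that at `1` by `1 - t`. -/
theorem abs_sinQuotient_le {r t : ℝ} (hr : 0 ≤ r) (h0 : 0 ≤ t) (h1 : t ≤ 1) :
    |sinQuotient r t| ≤ π * r := by
  have hpi := pi_pos
  have hs : 2 * t * (1 - t) ≤ sin (π * t) := by
    rcases le_total t (1 / 2) with h | h
    · have := mul_le_sin (x := π * t) (by positivity) (by nlinarith)
      have e : 2 / π * (π * t) = 2 * t := by field_simp
      rw [e] at this
      nlinarith
    · have := mul_le_sin (x := π * (1 - t)) (by nlinarith) (by nlinarith)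
      have e : 2 / π * (π * (1 - t)) = 2 * (1 - t) := by field_simp
      have e2 : sin (π * (1 - t)) = sin (π * t) := by
        rw [mul_sub, mul_one, sin_pi_sub]
      rw [e, e2] at this
      nlinarith
  have hs0 : 0 ≤ sin (π * t) := le_trans (by nlinarith) hs
  -- When the denominator vanishes the quotient is zero by convention.
  rcases eq_or_lt_of_le hs0 with h | h
  · rw [sinQuotient, ← h, div_zero, abs_zero]; positivity
  rw [sinQuotient, abs_div, abs_mul, abs_of_pos h, div_le_iff₀ h, abs_of_nonneg (by linarith : 0 ≤ 1 - t)]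
  have h2 : |sin (2 * π * r * t)| ≤ 2 * π * r * t :=
    abs_sin_le_abs.trans_eq (abs_of_nonneg (by positivity))
  calc (1 - t) * |sin (2 * π * r * t)| ≤ (1 - t) * (2 * π * r * t) := by
        gcongr
    _ = π * r * (2 * t * (1 - t)) := by ring
    _ ≤ _ := by gcongr

theorem abs_selbergDensity_le {r σ t : ℝ} (hr : 0 ≤ r) (h0 : 0 ≤ t) (h1 : t ≤ 1) :
    |selbergDensity r σ t| ≤ π * r + 1 + |σ| := by
  have h2 := abs_sinQuotient_le hr h0 h1
  have e1 : |sinQuotient r t * cos (π * t)| ≤ π * r := by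
    rw [abs_mul]
    calc _ ≤ (π * r) * 1 := by gcongr; exact abs_cos_le_one _
      _ = _ := mul_one _
  have e2 : |sin (2 * π * r * t) / π| ≤ 1 := by
    rw [abs_div, abs_of_pos pi_pos, div_le_one pi_pos]
    exact (abs_sin_le_one _).trans (by linarith [pi_gt_three])
  have e3 : |σ * ((1 - t) * cos (2 * π * r * t))| ≤ |σ| := by
    rw [abs_mul, abs_mul]
    have : |1 - t| ≤ 1 := by rw [abs_le]; constructor <;> linarith
    calc _ ≤ |σ| * (1 * 1) := by gcongr; exact abs_cos_le_one _
      _ = _ := by ring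
  exact (abs_add_le _ _).trans (add_le_add ((abs_add_le _ _).trans (add_le_add e1 e2)) e3)

/-- The Fourier transform at zero frequency is the integral of the majorant or minorant, the length
`2r` of the interval plus `σ`. This is the source of the constants `c₊` and `c₋`. A limit is needed
because the quotient has its conventional value zero at `t = 0`. -/
theorem tendsto_selbergDensity (r σ : ℝ) :
    Tendsto (selbergDensity r σ) (nhdsWithin 0 (Ioi 0)) (nhds (2 * r + σ)) := by
  have hpi := pi_pos
  have hd : ∀ a : ℝ, Tendsto (fun t => sin (a * t) / t) (nhdsWithin 0 (Ioi 0)) (nhds a) := by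
    intro a
    have h0 : HasDerivAt (fun t : ℝ => sin (a * t)) a 0 := by
      have h0 : HasDerivAt (fun t : ℝ => a * t) a 0 := by
        simpa using (hasDerivAt_id (0 : ℝ)).const_mul a
      simpa using h0.sin
    have := h0.tendsto_slope_zero_right
    refine this.congr fun t => ?_
    simp [div_eq_inv_mul]
  have hc : ∀ f : ℝ → ℝ, Continuous f → Tendsto f (nhdsWithin 0 (Ioi 0)) (nhds (f 0)) :=
    fun f hf => (hf.tendsto 0).mono_left nhdsWithin_le_nhds
  have hq : Tendsto (sinQuotient r) (nhdsWithin 0 (Ioi 0)) (nhds (2 * r)) := by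
    have h1 := (hc (fun t => 1 - t) (by fun_prop)).mul ((hd (2 * π * r)).div (hd π) hpi.ne')
    have e : (1 - 0) * (2 * π * r / π) = 2 * r := by field_simp; ring
    rw [e] at h1
    refine h1.congr' ?_
    filter_upwards [self_mem_nhdsWithin] with t ht
    have : t ≠ 0 := ne_of_gt ht
    simp only [Pi.div_apply]
    rw [div_div_div_cancel_right₀ this, sinQuotient, mul_div_assoc]
  have h2 := (hq.mul (hc (fun t => cos (π * t)) (by fun_prop))).add
    (hc (fun t => sin (2 * π * r * t) / π + σ * ((1 - t) * cos (2 * π * r * t))) (by fun_prop))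
  simp only [mul_zero, cos_zero, sin_zero, zero_div, mul_one, sub_zero, zero_add] at h2
  refine h2.congr fun t => ?_
  rw [selbergDensity]; ring

theorem intervalIntegrable_sinQuotient_mul (r : ℝ) (hr : 0 ≤ r) {f : ℝ → ℝ} (hf : Continuous f) :
    IntervalIntegrable (fun t => sinQuotient r t * f t) volume 0 1 := by
  refine IntervalIntegrable.mul_continuousOn ?_ hf.continuousOn
  rw [intervalIntegrable_iff_integrableOn_Ioc_of_le zero_le_one]
  refine Measure.integrableOn_of_bounded (M := π * r) (by simp)
    (measurable_sinQuotient r).aestronglyMeasurable ?_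
  filter_upwards [ae_restrict_mem measurableSet_Ioc] with t ht
  exact abs_sinQuotient_le hr ht.1.le ht.2

/-- The Riemann-Lebesgue lemma for cosines of odd frequency. -/
theorem tendsto_integral_mul_cos_odd {f : ℝ → ℝ} (hf : IntervalIntegrable f volume 0 1) :
    Tendsto (fun N : ℕ => ∫ t in (0 : ℝ)..1, f t * cos ((2 * N + 1) * π * t)) atTop (nhds 0) := by
  let F : ℝ → ℂ := (Ioc (0 : ℝ) 1).indicator fun t => (f t : ℂ)
  have hw : Tendsto (fun N : ℕ => (2 * (N : ℝ) + 1) / 2) atTop (cocompact ℝ) := by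
    refine Tendsto.mono_right ?_ atTop_le_cocompact
    refine Tendsto.atTop_div_const two_pos (tendsto_atTop_add_const_right _ _ ?_)
    exact tendsto_natCast_atTop_atTop.const_mul_atTop two_pos
  have h := (Real.tendsto_integral_exp_smul_cocompact F).comp hw
  have hre := (Complex.continuous_re.tendsto 0).comp h
  rw [Complex.zero_re] at hre
  refine hre.congr fun N => ?_
  simp only [Function.comp_apply]
  have e : ∀ v : ℝ, (fourierChar (-(v * ((2 * (N : ℝ) + 1) / 2))) • F v)
      = (Ioc (0 : ℝ) 1).indicator
        (fun t => (f t : ℂ) * Complex.exp ((-((2 * N + 1) * π * t) : ℝ) * Complex.I)) v := by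
    intro v
    by_cases hv : v ∈ Ioc (0 : ℝ) 1
    · simp only [F, indicator_of_mem hv, Circle.smul_def, smul_eq_mul, fourierChar_apply]
      rw [mul_comm]
      congr 3
      push_cast; ring
    · simp [F, indicator_of_notMem hv]
  simp only [e]
  rw [integral_indicator measurableSet_Ioc, intervalIntegral.integral_of_le zero_le_one,
    ← RCLike.re_eq_complex_re, ← integral_re]
  · refine setIntegral_congr_fun measurableSet_Ioc fun t _ => ?_
    simp only [RCLike.re_eq_complex_re]
    rw [Complex.re_ofReal_mul, Complex.exp_ofReal_mul_I_re, cos_neg]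
  · have hi : IntegrableOn f (Ioc 0 1) :=
      (intervalIntegrable_iff_integrableOn_Ioc_of_le zero_le_one).1 hf
    refine (hi.ofReal (𝕜 := ℂ)).mul_bdd (c := 1) ?_ ?_
    · apply Continuous.aestronglyMeasurable; fun_prop
    · exact Eventually.of_forall fun t => (Complex.norm_exp_ofReal_mul_I _).le

/-- The conjugate Dirichlet kernel, by telescoping cosines. The term with `N` oscillates and
disappears by Riemann-Lebesgue. -/
theorem two_mul_sin_mul_sum_sin (N : ℕ) (t : ℝ) :
    2 * sin (π * t) * ∑ n ∈ Finset.range N, sin (2 * π * (n + 1) * t)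
      = cos (π * t) - cos ((2 * N + 1) * π * t) := by
  induction N with
  | zero => simp
  | succ N ih =>
    rw [Finset.sum_range_succ, mul_add, ih]
    have h1 := cos_sub_cos ((2 * N + 1) * π * t) ((2 * (N + 1 : ℕ) + 1) * π * t)
    push_cast at h1 ⊢
    rw [show ((2 * N + 1) * π * t + (2 * (N + 1) + 1) * π * t) / 2 = 2 * π * (N + 1) * t by ring,
      show ((2 * N + 1) * π * t - (2 * (N + 1) + 1) * π * t) / 2 = -(π * t) by ring, sin_neg] at h1
    linarith

/-- Each Fejér kernel and the correction term is an integral over `[0, 1]`. After addition formulas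
the sum over `n` is the conjugate Dirichlet kernel, whose stationary part is the sign part of
`selbergDensity`. -/
theorem signApprox_sub_eq_integral {r : ℝ} (hr : 0 ≤ r) (x : ℝ) (N : ℕ) :
    (signApprox N (x + r) - signApprox N (x - r)) / 2
      = 2 * (∫ t in (0 : ℝ)..1, (sinQuotient r t * cos (π * t) + sin (2 * π * r * t) / π)
          * cos (2 * π * x * t))
        - 2 * ∫ t in (0 : ℝ)..1, sinQuotient r t * cos (2 * π * x * t)
          * cos ((2 * N + 1) * π * t) := by
  have hpi := pi_pos
  have hII : ∀ f : ℝ → ℝ, Continuous f → IntervalIntegrable f volume 0 1 :=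
    fun f hf => hf.intervalIntegrable _ _
  have h1 : (∑ n ∈ Finset.range N,
        (sinc (π * (x + r - (n + 1))) ^ 2 - sinc (π * (x + r + (n + 1))) ^ 2)
      - ∑ n ∈ Finset.range N,
        (sinc (π * (x - r - (n + 1))) ^ 2 - sinc (π * (x - r + (n + 1))) ^ 2)) / 2
      = ∫ t in (0 : ℝ)..1, 4 * (1 - t) * cos (2 * π * x * t) * sin (2 * π * r * t)
          * ∑ n ∈ Finset.range N, sin (2 * π * (n + 1) * t) := by
    rw [← Finset.sum_sub_distrib, Finset.sum_div]
    simp only [Finset.mul_sum]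
    rw [intervalIntegral.integral_finsetSum fun n _ => hII _ (by fun_prop)]
    refine Finset.sum_congr rfl fun n _ => ?_
    simp only [← two_mul_integral_one_sub_mul_cos]
    rw [← mul_sub, ← mul_sub, ← mul_sub, mul_div_cancel_left₀ _ two_ne_zero,
      ← intervalIntegral.integral_sub (hII _ (by fun_prop)) (hII _ (by fun_prop)),
      ← intervalIntegral.integral_sub (hII _ (by fun_prop)) (hII _ (by fun_prop)),
      ← intervalIntegral.integral_sub (hII _ (by fun_prop)) (hII _ (by fun_prop))]
    congr 1; ext t
    have e1 : ∀ a b : ℝ, cos (2 * π * (a - b) * t) - cos (2 * π * (a + b) * t)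
        = 2 * sin (2 * π * a * t) * sin (2 * π * b * t) := fun a b => by
      rw [show 2 * π * (a - b) * t = 2 * π * a * t - 2 * π * b * t by ring,
        show 2 * π * (a + b) * t = 2 * π * a * t + 2 * π * b * t by ring, cos_sub, cos_add]
      ring
    have e2 : sin (2 * π * (x + r) * t) - sin (2 * π * (x - r) * t)
        = 2 * cos (2 * π * x * t) * sin (2 * π * r * t) := by
      rw [show 2 * π * (x + r) * t = 2 * π * x * t + 2 * π * r * t by ring,
        show 2 * π * (x - r) * t = 2 * π * x * t - 2 * π * r * t by ring, sin_sub, sin_add]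
      ring
    rw [← mul_sub, ← mul_sub, ← mul_sub, e1, e1, ← sub_mul, ← mul_sub, e2]
    ring
  have h2 : (2 / π * (sin (π * (x + r)) ^ 2 / (π * (x + r)))
      - 2 / π * (sin (π * (x - r)) ^ 2 / (π * (x - r)))) / 2
      = ∫ t in (0 : ℝ)..1, 2 * (sin (2 * π * r * t) / π) * cos (2 * π * x * t) := by
    rw [← integral_sin_two_pi_mul, ← integral_sin_two_pi_mul, ← mul_sub,
      ← intervalIntegral.integral_sub (hII _ (by fun_prop)) (hII _ (by fun_prop)),
      mul_div_right_comm, ← intervalIntegral.integral_const_mul]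
    congr 1; ext t
    rw [show 2 * π * (x + r) * t = 2 * π * x * t + 2 * π * r * t by ring,
      show 2 * π * (x - r) * t = 2 * π * x * t - 2 * π * r * t by ring, sin_sub, sin_add]
    ring
  have hI2 := intervalIntegrable_sinQuotient_mul r hr (f := fun t => cos (2 * π * x * t)
    * cos ((2 * N + 1) * π * t)) (by fun_prop)
  have hI1 := (intervalIntegrable_sinQuotient_mul r hr
    (f := fun t => cos (π * t) * cos (2 * π * x * t)) (by fun_prop)).add
    (hII (fun t => sin (2 * π * r * t) / π * cos (2 * π * x * t)) (by fun_prop))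
  simp only [← mul_assoc, ← add_mul] at hI1 hI2
  rw [← mul_sub, ← intervalIntegral.integral_sub hI1 hI2, ← intervalIntegral.integral_const_mul]
  calc _ = _ := by
        rw [signApprox, signApprox, add_sub_add_comm, add_div, h1, h2,
          ← intervalIntegral.integral_add (hII _ (by fun_prop)) (hII _ (by fun_prop))]
    _ = _ := by
        refine intervalIntegral.integral_congr_ae ?_
        -- The closed form of the kernel divides by `sin(πt)`, which vanishes at this endpoint.
        have : ∀ᵐ t : ℝ, t ≠ 1 := by simp [ae_iff]
        filter_upwards [this] with t ht hmem
        rw [uIoc_of_le zero_le_one] at hmem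
        have hlt : t < 1 := lt_of_le_of_ne hmem.2 ht
        have hs : sin (π * t) ≠ 0 :=
          (sin_pos_of_pos_of_lt_pi (mul_pos hpi hmem.1) (by nlinarith)).ne'
        have h := two_mul_sin_mul_sum_sin N t
        have e : ∑ n ∈ Finset.range N, sin (2 * π * (n + 1) * t)
            = (cos (π * t) - cos ((2 * N + 1) * π * t)) / (2 * sin (π * t)) := by
          rw [eq_div_iff (mul_ne_zero two_ne_zero hs), ← h]; ring
        rw [e, sinQuotient]
        field_simp
        ring

theorem tendsto_signApprox_sub {r : ℝ} (hr : 0 ≤ r) (σ x : ℝ) :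
    Tendsto (fun N => (signApprox N (x + r) - signApprox N (x - r)) / 2
        + σ * (sinc (π * (x + r)) ^ 2 + sinc (π * (x - r)) ^ 2) / 2) atTop
      (nhds (2 * ∫ t in (0 : ℝ)..1, selbergDensity r σ t * cos (2 * π * x * t))) := by
  have hII : ∀ f : ℝ → ℝ, Continuous f → IntervalIntegrable f volume 0 1 :=
    fun f hf => hf.intervalIntegrable _ _
  have hI := intervalIntegrable_sinQuotient_mul r hr
    (f := fun t => cos (2 * π * x * t)) (by fun_prop)
  have hI1 := (intervalIntegrable_sinQuotient_mul r hr
    (f := fun t => cos (π * t) * cos (2 * π * x * t)) (by fun_prop)).add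
    (hII (fun t => sin (2 * π * r * t) / π * cos (2 * π * x * t)) (by fun_prop))
  simp only [← mul_assoc, ← add_mul] at hI1
  have h1 : σ * (sinc (π * (x + r)) ^ 2 + sinc (π * (x - r)) ^ 2) / 2
      = 2 * ∫ t in (0 : ℝ)..1, σ * ((1 - t) * cos (2 * π * r * t)) * cos (2 * π * x * t) := by
    rw [← two_mul_integral_one_sub_mul_cos, ← two_mul_integral_one_sub_mul_cos, ← mul_add,
      ← intervalIntegral.integral_add (hII _ (by fun_prop)) (hII _ (by fun_prop)),
      mul_left_comm, mul_div_cancel_left₀ _ two_ne_zero, ← intervalIntegral.integral_const_mul,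
      ← intervalIntegral.integral_const_mul]
    congr 1; ext t
    rw [show 2 * π * (x + r) * t = 2 * π * x * t + 2 * π * r * t by ring,
      show 2 * π * (x - r) * t = 2 * π * x * t - 2 * π * r * t by ring, cos_sub, cos_add]
    ring
  have h2 : ∫ t in (0 : ℝ)..1, selbergDensity r σ t * cos (2 * π * x * t)
      = (∫ t in (0 : ℝ)..1, (sinQuotient r t * cos (π * t) + sin (2 * π * r * t) / π)
          * cos (2 * π * x * t))
        + ∫ t in (0 : ℝ)..1, σ * ((1 - t) * cos (2 * π * r * t)) * cos (2 * π * x * t) := by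
    rw [← intervalIntegral.integral_add hI1 (hII _ (by fun_prop))]
    congr 1; ext t
    rw [selbergDensity]; ring
  rw [h1, h2, mul_add]
  refine Tendsto.add_const _ ?_
  simp only [signApprox_sub_eq_integral hr]
  simpa using ((tendsto_integral_mul_cos_odd hI).const_mul 2).const_sub
    (2 * ∫ t in (0 : ℝ)..1, (sinQuotient r t * cos (π * t) + sin (2 * π * r * t) / π)
          * cos (2 * π * x * t))

/-- Selberg's majorant of an interval. -/
theorem indicator_le_selberg {r : ℝ} (hr : 0 ≤ r) (x : ℝ) :
    (Icc (-r) r).indicator 1 x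
      ≤ 2 * ∫ t in (0 : ℝ)..1, selbergDensity r 1 t * cos (2 * π * x * t) := by
  obtain ⟨e, he, h1, h2, -, -⟩ := exists_signApprox_bounds (x + r)
  obtain ⟨e', he', -, -, h3, h4⟩ := exists_signApprox_bounds (x - r)
  have hlim : Tendsto (fun N => (Icc (-r) r).indicator (1 : ℝ → ℝ) x - (e N + e' N) / 2) atTop
      (nhds ((Icc (-r) r).indicator (1 : ℝ → ℝ) x)) := by
    simpa using ((he.add he').div_const 2).const_sub ((Icc (-r) r).indicator (1 : ℝ → ℝ) x)
  refine le_of_tendsto_of_tendsto' hlim (tendsto_signApprox_sub hr 1 x) fun N => ?_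
  -- The indicator is half the difference of the signs of `x + r` and `x - r`: majorize the first
  -- and minorize the second. The bounds hold on closed half-lines, so the endpoints of the interval
  -- are covered.
  by_cases hx : x ∈ Icc (-r) r
  · rw [indicator_of_mem hx, Pi.one_apply]
    have := h1 (by linarith [hx.1]) N
    have := h3 (by linarith [hx.2]) N
    linarith
  · rw [indicator_of_notMem hx]
    rcases lt_or_ge x (-r) with h | h
    · have := h2 N
      have := h3 (by linarith) N
      linarith
    · have := h1 (by linarith) N
      have := h4 N
      linarith

/-- Selberg's minorant of an interval. -/
theorem selberg_le_indicator {r : ℝ} (hr : 0 ≤ r) (x : ℝ) :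
    2 * ∫ t in (0 : ℝ)..1, selbergDensity r (-1) t * cos (2 * π * x * t)
      ≤ (Icc (-r) r).indicator 1 x := by
  obtain ⟨e, he, -, -, h1, h2⟩ := exists_signApprox_bounds (x + r)
  obtain ⟨e', he', h3, h4, -, -⟩ := exists_signApprox_bounds (x - r)
  have hlim : Tendsto (fun N => (Icc (-r) r).indicator (1 : ℝ → ℝ) x + (e N + e' N) / 2) atTop
      (nhds ((Icc (-r) r).indicator (1 : ℝ → ℝ) x)) := by
    simpa using ((he.add he').div_const 2).const_add ((Icc (-r) r).indicator (1 : ℝ → ℝ) x)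
  refine le_of_tendsto_of_tendsto' (tendsto_signApprox_sub hr (-1) x) hlim fun N => ?_
  by_cases hx : x ∈ Icc (-r) r
  · rw [indicator_of_mem hx, Pi.one_apply]
    have := h2 N
    have := h4 N
    linarith
  · rw [indicator_of_notMem hx]
    rcases lt_or_ge x (-r) with h | h
    · have := h1 (by linarith) N
      have := h4 N
      linarith
    · have hxr : r < x := by
        by_contra! hcon
        exact hx ⟨h, hcon⟩
      have := h2 N
      have := h3 (by linarith) N
      linarith

/-! ### Saddle-point asymptotics -/

/-- An integrable majorant independent of `N`. For `v² ≤ N` the exponent is at least `v²/2`; beyond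
that it is at least `N/2`, and `v²` is at most polynomial in `N`. The constant `48 = 2³ · 3!` comes
from the cubic term of the exponential series at `N/2`. -/
theorem exp_neg_le_of_sq_le {A ω N v : ℝ} (hA : 0 < A) (hN : 0 < N)
    (hv : v ^ 2 ≤ ω ^ 2 * N ^ 3 / A ^ 2) :
    exp (-(v ^ 2 / (1 + v ^ 2 / N))) ≤ (2 + 48 * ω ^ 2 / A ^ 2) * (1 + v ^ 2)⁻¹ := by
  have h1 : 0 < 1 + v ^ 2 := by positivity
  have hC : 0 ≤ 48 * ω ^ 2 / A ^ 2 := by positivity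
  rw [← div_eq_mul_inv, le_div_iff₀ h1, exp_neg, inv_mul_le_iff₀ (exp_pos _)]
  rcases le_total (v ^ 2) N with h | h
  · have h2 : v ^ 2 / 2 ≤ v ^ 2 / (1 + v ^ 2 / N) := by
      gcongr
      have : v ^ 2 / N ≤ 1 := by rwa [div_le_one hN]
      linarith
    have h3 := (add_one_le_exp (v ^ 2 / 2)).trans (exp_le_exp.2 h2)
    nlinarith [exp_pos (v ^ 2 / (1 + v ^ 2 / N))]
  · have h2 : N / 2 ≤ v ^ 2 / (1 + v ^ 2 / N) := by
      rw [div_le_div_iff₀ two_pos (by positivity)]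
      have : N * (v ^ 2 / N) = v ^ 2 := by field_simp
      nlinarith
    have h3 := exp_le_exp.2 h2
    have h4 : N ^ 3 ≤ 48 * exp (N / 2) := by
      have := pow_div_factorial_le_exp (N / 2) (by positivity) 3
      have e : (Nat.factorial 3 : ℝ) = 6 := by norm_num [Nat.factorial]
      rw [e, div_le_iff₀ (by norm_num), div_pow] at this
      linarith
    have h5 : 1 ≤ exp (N / 2) := one_le_exp (by positivity)
    calc 1 + v ^ 2 ≤ 1 + ω ^ 2 / A ^ 2 * N ^ 3 := by
          have : ω ^ 2 / A ^ 2 * N ^ 3 = ω ^ 2 * N ^ 3 / A ^ 2 := by ring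
          linarith
      _ ≤ exp (N / 2) + ω ^ 2 / A ^ 2 * (48 * exp (N / 2)) := by gcongr
      _ ≤ exp (N / 2) * (2 + 48 * ω ^ 2 / A ^ 2) := by
          have : ω ^ 2 / A ^ 2 * (48 * exp (N / 2)) = exp (N / 2) * (48 * ω ^ 2 / A ^ 2) := by ring
          linarith
      _ ≤ _ := by gcongr

theorem norm_exp_neg_sq_div (v w : ℝ) :
    ‖Complex.exp (-((v : ℂ) ^ 2 / (1 + w * Complex.I)))‖ = exp (-(v ^ 2 / (1 + w ^ 2))) := by
  rw [Complex.norm_exp]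
  congr 1
  rw [Complex.neg_re, ← Complex.ofReal_pow, div_eq_mul_inv, Complex.re_ofReal_mul, Complex.inv_re]
  have h1 : (1 + w * Complex.I : ℂ).re = 1 := by simp
  have h2 : Complex.normSq (1 + w * Complex.I) = 1 + w ^ 2 := by
    rw [Complex.normSq_apply]; simp; ring
  rw [h1, h2, one_div, div_eq_mul_inv]

/-- The exponent `s Δ + A / s` at `s = β (1 + iu)`, where `β = √(A / Δ)` is its critical point. -/
theorem saddle_exponent {A β : ℝ} (hβ : 0 < β) (u : ℝ) :
    (β * (1 + u * Complex.I) : ℂ) * (A / β ^ 2) + A / (β * (1 + u * Complex.I))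
      = 2 * (A / β) - A / β * u ^ 2 / (1 + u * Complex.I) := by
  have h1 : (1 + u * Complex.I : ℂ) ≠ 0 := fun h => by
    have := congrArg Complex.re h; simp at this
  have h2 : (β : ℂ) ≠ 0 := by exact_mod_cast hβ.ne'
  field_simp
  ring_nf
  rw [Complex.I_sq]
  ring

/-- The leading asymptotics of a Laplace-type integral near its saddle point. -/
theorem tendsto_saddle_integral {A ω a M ψ₀ : ℝ} (hA : 0 < A) (hω : 0 < ω) {ψ : ℝ → ℝ}
    (hψm : Measurable ψ) (hψ : ∀ t, 0 ≤ t → t ≤ 1 → |ψ t| ≤ M)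
    (hψ0 : Tendsto ψ (nhdsWithin 0 (Ioi 0)) (nhds ψ₀)) :
    Tendsto (fun β : ℝ => ((exp (-(2 * (A / β))) / (β * √(β / A) / ω) : ℝ) : ℂ)
        * ∫ t in (0 : ℝ)..1, (ψ t : ℂ)
          * (Complex.exp ((⟨β, ω * t⟩ : ℂ) * (A / β ^ 2)) * Complex.exp (-⟨β, ω * t⟩ * a)
            * Complex.exp (A / (⟨β, ω * t⟩ : ℂ))))
      (nhdsWithin 0 (Ioi 0)) (nhds ((ψ₀ * (√π / 2) : ℝ) : ℂ)) := by
  have hM : 0 ≤ M := (abs_nonneg _).trans (hψ 0 le_rfl zero_le_one)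
  -- With `s = β(1 + iu)` the quadratic term of the exponent is `(A/β)u²`; `u = κv` normalises it to
  -- `v²`, and `lam` is the resulting factor between `v` and `t`, so that `ωt = βu`.
  let κ : ℝ → ℝ := fun β => √(β / A)
  let lam : ℝ → ℝ := fun β => β * κ β / ω
  let Ψ : ℝ → ℂ := (Ioc (0 : ℝ) 1).indicator fun t => (ψ t : ℂ)
  let F : ℝ → ℝ → ℂ := fun β v => Ψ (lam β * v)
    * (Complex.exp (-(β * (1 + (v * κ β : ℝ) * Complex.I)) * a)
      * Complex.exp (-((v : ℂ) ^ 2 / (1 + (v * κ β : ℝ) * Complex.I))))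
  have hκ : Tendsto κ (nhdsWithin 0 (Ioi 0)) (nhds 0) := by
    have : Continuous κ := by fun_prop
    exact (this.tendsto' 0 0 (by simp [κ])).mono_left nhdsWithin_le_nhds
  have hid : Tendsto (fun β : ℝ => β) (nhdsWithin 0 (Ioi 0)) (nhds 0) :=
    tendsto_id.mono_left nhdsWithin_le_nhds
  have hκpos : ∀ β, 0 < β → 0 < κ β := fun β hβ => Real.sqrt_pos.2 (by positivity)
  have hlampos : ∀ β, 0 < β → 0 < lam β := fun β hβ => by have := hκpos β hβ; positivity
  have hlam : Tendsto lam (nhdsWithin 0 (Ioi 0)) (nhds 0) := by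
    simpa using (hid.mul hκ).div_const ω
  have hΨm : Measurable Ψ := (Complex.measurable_ofReal.comp hψm).indicator measurableSet_Ioc
  have hmain : Tendsto (fun β => ∫ v in Ioi (0 : ℝ), F β v) (nhdsWithin 0 (Ioi 0))
      (nhds (∫ v in Ioi (0 : ℝ), ((ψ₀ * exp (-1 * v ^ 2) : ℝ) : ℂ))) := by
    refine tendsto_integral_filter_of_dominated_convergence
      (fun v => M * exp |a| * ((2 + 48 * ω ^ 2 / A ^ 2) * (1 + v ^ 2)⁻¹)) ?_ ?_ ?_ ?_
    · refine Eventually.of_forall fun β => Measurable.aestronglyMeasurable ?_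
      have : Measurable fun v => Ψ (lam β * v) := hΨm.comp (measurable_const_mul _)
      simp only [F]
      fun_prop
    · filter_upwards [Ioc_mem_nhdsGT (zero_lt_one (α := ℝ))] with β hβ
      have hβ0 : 0 < β := hβ.1
      filter_upwards [ae_restrict_mem measurableSet_Ioi] with v hv
      have hv : 0 < v := hv
      by_cases hmem : lam β * v ∈ Ioc (0 : ℝ) 1
      · simp only [F, norm_mul]
        rw [mul_assoc]
        have e1 : ‖Ψ (lam β * v)‖ ≤ M := by
          rw [show Ψ (lam β * v) = (ψ (lam β * v) : ℂ) from indicator_of_mem hmem _,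
            Complex.norm_real]
          exact hψ _ hmem.1.le hmem.2
        have e2 : ‖Complex.exp (-(β * (1 + (v * κ β : ℝ) * Complex.I)) * a)‖ ≤ exp |a| := by
          rw [Complex.norm_exp]
          have : (-(β * (1 + (v * κ β : ℝ) * Complex.I)) * a : ℂ).re = -(β * a) := by
            rw [Complex.re_mul_ofReal, Complex.neg_re, Complex.re_ofReal_mul]
            simp
          rw [this]
          refine exp_le_exp.2 ((neg_le_abs _).trans ?_)
          rw [abs_mul, abs_of_pos hβ0]
          exact mul_le_of_le_one_left (abs_nonneg _) hβ.2
        have e3 : ‖Complex.exp (-((v : ℂ) ^ 2 / (1 + (v * κ β : ℝ) * Complex.I)))‖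
            ≤ (2 + 48 * ω ^ 2 / A ^ 2) * (1 + v ^ 2)⁻¹ := by
          rw [norm_exp_neg_sq_div]
          have hk2 : κ β ^ 2 = β / A := Real.sq_sqrt (by positivity)
          have e4 : (v * κ β) ^ 2 = v ^ 2 / (A / β) := by
            rw [mul_pow, hk2]; field_simp
          rw [e4]
          refine exp_neg_le_of_sq_le hA (by positivity) ?_
          have h5 : (lam β * v) ^ 2 ≤ 1 := by
            have := hmem.1; have := hmem.2; nlinarith
          -- The cutoff `t ≤ 1` becomes the polynomial bound on `v²` of `exp_neg_le_of_sq_le`, with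
          -- `N = A / β`.
          have h6 : (lam β * v) ^ 2 = β ^ 3 * v ^ 2 / (A * ω ^ 2) := by
            simp only [lam]; rw [mul_pow, div_pow, mul_pow, hk2]; field_simp
          rw [h6, div_le_one (by positivity)] at h5
          rw [le_div_iff₀ (by positivity), div_pow, mul_div_assoc', le_div_iff₀ (by positivity)]
          nlinarith [mul_le_mul_of_nonneg_left h5 (sq_nonneg A)]
        gcongr
      · rw [show F β v = 0 by simp [F, Ψ, indicator_of_notMem hmem], norm_zero]
        positivity
    · exact ((integrable_inv_one_add_sq.const_mul _).const_mul _).integrableOn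
    · filter_upwards [ae_restrict_mem measurableSet_Ioi] with v hv
      have hv : 0 < v := hv
      have h1 : Tendsto (fun β => Ψ (lam β * v)) (nhdsWithin 0 (Ioi 0)) (nhds (ψ₀ : ℂ)) := by
        have hz : Tendsto (fun β => lam β * v) (nhdsWithin 0 (Ioi 0)) (nhdsWithin 0 (Ioi 0)) := by
          refine tendsto_nhdsWithin_iff.2 ⟨by simpa using hlam.mul_const v, ?_⟩
          filter_upwards [self_mem_nhdsWithin] with β hβ
          exact mul_pos (hlampos β hβ) hv
        have hΨ0 : Tendsto Ψ (nhdsWithin 0 (Ioi 0)) (nhds (ψ₀ : ℂ)) := by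
          refine ((Complex.continuous_ofReal.tendsto ψ₀).comp hψ0).congr' ?_
          filter_upwards [Ioc_mem_nhdsGT (zero_lt_one (α := ℝ))] with t ht
          exact (indicator_of_mem ht (fun t => (ψ t : ℂ))).symm
        exact hΨ0.comp hz
      have h2 : Tendsto (fun β => ((v * κ β : ℝ) : ℂ)) (nhdsWithin 0 (Ioi 0)) (nhds 0) := by
        have := (Complex.continuous_ofReal.tendsto 0).comp
          (show Tendsto (fun β => v * κ β) (nhdsWithin 0 (Ioi 0)) (nhds 0) by
            simpa using hκ.const_mul v)
        simpa [Function.comp_def] using this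
      have h3 : Tendsto (fun β : ℝ => (β : ℂ)) (nhdsWithin 0 (Ioi 0)) (nhds 0) := by
        simpa [Function.comp_def] using (Complex.continuous_ofReal.tendsto 0).comp hid
      have h4 : Tendsto (fun β => 1 + ((v * κ β : ℝ) : ℂ) * Complex.I) (nhdsWithin 0 (Ioi 0))
          (nhds 1) := by
        simpa using (h2.mul_const Complex.I).const_add 1
      have h5 := ((h3.mul h4).neg.mul_const (a : ℂ)).cexp
      have h6 := ((tendsto_const_nhds (x := (v : ℂ) ^ 2)).div h4 one_ne_zero).neg.cexp
      have h7 := h1.mul (h5.mul h6)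
      simp only [zero_mul, neg_zero, Complex.exp_zero, one_mul, div_one] at h7
      convert! h7 using 2
      push_cast
      simp
  have hlimit : (∫ v in Ioi (0 : ℝ), ((ψ₀ * exp (-1 * v ^ 2) : ℝ) : ℂ))
      = ((ψ₀ * (√π / 2) : ℝ) : ℂ) := by
    rw [integral_complex_ofReal, integral_const_mul, integral_gaussian_Ioi, div_one]
  rw [hlimit] at hmain
  refine hmain.congr' ?_
  filter_upwards [self_mem_nhdsWithin] with β hβ
  have hβ : 0 < β := hβ
  let E : ℝ → ℂ := fun t => Ψ t
    * (Complex.exp ((⟨β, ω * t⟩ : ℂ) * (A / β ^ 2)) * Complex.exp (-⟨β, ω * t⟩ * a)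
            * Complex.exp (A / (⟨β, ω * t⟩ : ℂ)))
  have hE : ∫ t in (0 : ℝ)..1, (ψ t : ℂ)
          * (Complex.exp ((⟨β, ω * t⟩ : ℂ) * (A / β ^ 2)) * Complex.exp (-⟨β, ω * t⟩ * a)
            * Complex.exp (A / (⟨β, ω * t⟩ : ℂ))) = ∫ t in Ioi (0 : ℝ), E t := by
    rw [intervalIntegral.integral_of_le zero_le_one, ← integral_indicator measurableSet_Ioc,
      ← integral_indicator measurableSet_Ioi]
    congr 1; ext t
    by_cases ht : t ∈ Ioc (0 : ℝ) 1
    · rw [indicator_of_mem ht, indicator_of_mem (show t ∈ Ioi 0 from ht.1)]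
      simp only [E, Ψ, indicator_of_mem ht]
    · rw [indicator_of_notMem ht]
      by_cases ht' : t ∈ Ioi (0 : ℝ)
      · rw [indicator_of_mem ht']; simp [E, Ψ, indicator_of_notMem ht]
      · rw [indicator_of_notMem ht']
  have hcomp := integral_comp_mul_left_Ioi E 0 (hlampos β hβ)
  rw [mul_zero] at hcomp
  have hFE : ∀ v, F β v = Complex.exp (-(2 * (A / β)) : ℝ) * E (lam β * v) := by
    intro v
    have hs : (⟨β, ω * (lam β * v)⟩ : ℂ) = β * (1 + (v * κ β : ℝ) * Complex.I) := by
      have : ω * (lam β * v) = β * (v * κ β) := by simp only [lam]; field_simp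
      rw [this]
      apply Complex.ext <;> simp
    simp only [F, E, hs]
    rw [mul_left_comm (Complex.exp _) (Ψ _)]
    congr 1
    rw [← Complex.exp_add, ← Complex.exp_add, ← Complex.exp_add, ← Complex.exp_add]
    congr 1
    have h8 := saddle_exponent (A := A) hβ (v * κ β)
    have h9 : (A / β : ℂ) * ((v * κ β : ℝ) : ℂ) ^ 2 = (v : ℂ) ^ 2 := by
      have hk2 : κ β ^ 2 = β / A := Real.sq_sqrt (by positivity)
      have : A / β * (v * κ β) ^ 2 = v ^ 2 := by rw [mul_pow, hk2]; field_simp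
      exact_mod_cast this
    rw [h9] at h8
    push_cast at h8 ⊢
    linear_combination -h8
  simp only [hFE]
  rw [integral_const_mul, hcomp, hE, Complex.real_smul]
  rw [← mul_assoc, ← Complex.ofReal_exp, ← Complex.ofReal_mul, ← div_eq_mul_inv]

/-! ### Band-limited smearing through the Laplace transform -/

/-- Exchange of sum and integral for an arbitrary family with a summable bound. -/
theorem hasSum_setIntegral_of_norm_le {ι : Type*} {S : Set ℝ} (hS : MeasurableSet S)
    (hfin : volume S ≠ ⊤) {F : ι → ℝ → ℂ} {u : ι → ℝ} (hu : Summable u)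
    (hm : ∀ i, Measurable (F i)) (hF : ∀ i, ∀ t ∈ S, ‖F i t‖ ≤ u i) :
    HasSum (fun i => ∫ t in S, F i t) (∫ t in S, ∑' i, F i t) := by
  -- The index type may be uncountable, as for scaling dimensions in `ℝ`; a summable bound has
  -- countable support, outside which all terms vanish on `S`.
  let T : Set ι := Function.support u
  have hT : Countable T := hu.countable_support
  have hzero : ∀ i ∉ T, ∀ t ∈ S, F i t = 0 := by
    intro i hi t ht
    have h0 : u i = 0 := by simpa [T] using hi
    exact norm_le_zero_iff.1 (h0 ▸ hF i t ht)
  have hint : ∀ i, IntegrableOn (F i) S := fun i =>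
    Measure.integrableOn_of_bounded hfin (hm i).aestronglyMeasurable
      ((ae_restrict_mem hS).mono fun t ht => hF i t ht)
  have h1 := hasSum_integral_of_summable_integral_norm (μ := volume.restrict S)
    (F := fun i : T => F i) (fun i => hint i) (by
      refine .of_nonneg_of_le (fun i => integral_nonneg fun _ => norm_nonneg _) (fun i => ?_)
        ((hu.subtype T).mul_right (volume.real S))
      have := norm_setIntegral_le_of_norm_le_const (f := fun t => ‖F i t‖) (C := u i)
        hfin.lt_top (fun t ht => by simpa using hF i t ht)
      exact (le_norm_self _).trans this)
  have h2 : ∫ t in S, ∑' i : T, F i t = ∫ t in S, ∑' i, F i t := by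
    refine setIntegral_congr_fun hS fun t ht => ?_
    refine tsum_subtype_eq_of_support_subset (f := fun i => F i t) fun i hi => ?_
    by_contra hcon
    exact hi (hzero i hcon t ht)
  rw [h2] at h1
  refine (hasSum_subtype_iff_of_support_subset (s := T) fun i hi => ?_).1 h1
  by_contra hcon
  refine hi ?_
  exact (setIntegral_congr_fun hS (fun t ht => hzero i hcon t ht)).trans (by simp)

theorem Complex.mk_eq_ofReal_add (x y : ℝ) : (⟨x, y⟩ : ℂ) = (x : ℂ) + ((y : ℝ) : ℂ) * Complex.I :=
  Complex.mk_eq_add_mul_I x y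

/-- The Laplace transform of the measure `∑ n(x) δ_x`. -/
def laplaceSum (n : ℝ → ℝ) (s : ℂ) : ℂ := ∑' x : ℝ, (n x : ℂ) * Complex.exp (-s * x)

theorem norm_mul_exp_neg {n : ℝ → ℝ} (hn : ∀ x, 0 ≤ n x) (s : ℂ) (x : ℝ) :
    ‖(n x : ℂ) * Complex.exp (-s * x)‖ = n x * exp (-s.re * x) := by
  rw [norm_mul, Complex.norm_real, norm_of_nonneg (hn x), Complex.norm_exp, Complex.re_mul_ofReal,
    Complex.neg_re]

theorem continuous_laplaceSum {n : ℝ → ℝ} (hn : ∀ x, 0 ≤ n x) {b : ℝ}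
    (hs : Summable fun x : ℝ => n x * exp (-b * x)) (ω : ℝ) :
    Continuous fun t : ℝ => laplaceSum n ⟨b, ω * t⟩ := by
  refine continuous_tsum (fun x => ?_) hs fun x t => (norm_mul_exp_neg hn _ x).le
  simp only [Complex.mk_eq_ofReal_add]
  fun_prop

/-- Smearing with a band-limited function, expressed by the Laplace transform on a vertical
segment. -/
theorem hasSum_mul_bandlimited {n : ℝ → ℝ} (hn : ∀ x, 0 ≤ n x) {b : ℝ}
    (hs : Summable fun x : ℝ => n x * exp (-b * x)) (D ω : ℝ) {ψ : ℝ → ℝ} (hψm : Measurable ψ)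
    {M : ℝ} (hψ : ∀ t, 0 ≤ t → t ≤ 1 → |ψ t| ≤ M) :
    HasSum (fun x : ℝ => n x * exp (-b * (x - D)) * ∫ t in (0 : ℝ)..1, ψ t * cos (ω * (x - D) * t))
      (∫ t in (0 : ℝ)..1, (ψ t : ℂ)
        * (Complex.exp ((⟨b, ω * t⟩ : ℂ) * D) * laplaceSum n ⟨b, ω * t⟩)).re := by
  let F : ℝ → ℝ → ℂ := fun x t => (ψ t : ℂ)
    * (Complex.exp ((⟨b, ω * t⟩ : ℂ) * D) * ((n x : ℂ) * Complex.exp (-(⟨b, ω * t⟩ : ℂ) * x)))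
  have hbound : ∀ x, ∀ t ∈ Ioc (0 : ℝ) 1, ‖F x t‖ ≤ M * exp (b * D) * (n x * exp (-b * x)) := by
    intro x t ht
    simp only [F]
    rw [norm_mul, norm_mul, norm_mul_exp_neg hn, Complex.norm_real, Complex.norm_exp,
      Complex.re_mul_ofReal, mul_assoc M]
    have := hn x
    gcongr
    exact hψ t ht.1.le ht.2
  have hmeas : ∀ x, Measurable (F x) := fun x => by
    simp only [F, Complex.mk_eq_ofReal_add]
    fun_prop
  have h := hasSum_setIntegral_of_norm_le measurableSet_Ioc (by simp) (hs.mul_left _) hmeas hbound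
  have h2 := Complex.reCLM.hasSum h
  rw [Complex.reCLM_apply] at h2
  have e1 : ∫ t in Ioc (0 : ℝ) 1, ∑' x, F x t = ∫ t in (0 : ℝ)..1, (ψ t : ℂ)
        * (Complex.exp ((⟨b, ω * t⟩ : ℂ) * D) * laplaceSum n ⟨b, ω * t⟩) := by
    rw [intervalIntegral.integral_of_le zero_le_one]
    refine setIntegral_congr_fun measurableSet_Ioc fun t _ => ?_
    simp only [F, laplaceSum, tsum_mul_left]
  rw [e1] at h2
  convert! h2 using 2 with x
  simp only [Complex.reCLM_apply]
  have hint : Integrable (F x) (volume.restrict (Ioc (0 : ℝ) 1)) :=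
    Measure.integrableOn_of_bounded (by simp) (hmeas x).aestronglyMeasurable
      ((ae_restrict_mem measurableSet_Ioc).mono fun t ht => hbound x t ht)
  rw [← RCLike.re_eq_complex_re, ← integral_re hint, intervalIntegral.integral_of_le zero_le_one,
    ← integral_const_mul]
  refine setIntegral_congr_fun measurableSet_Ioc fun t _ => ?_
  simp only [F, RCLike.re_eq_complex_re]
  have e2 : (ψ t : ℂ) * (Complex.exp ((⟨b, ω * t⟩ : ℂ) * D)
      * ((n x : ℂ) * Complex.exp (-(⟨b, ω * t⟩ : ℂ) * x)))
      = ((ψ t * n x * exp (-b * (x - D)) : ℝ) : ℂ)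
        * Complex.exp ((-(ω * (x - D) * t) : ℝ) * Complex.I) := by
    push_cast
    rw [Complex.mk_eq_ofReal_add, mul_left_comm (Complex.exp _), ← Complex.exp_add,
      mul_assoc (_ * _ : ℂ), ← Complex.exp_add, mul_assoc]
    congr 3
    push_cast; ring
  rw [e2, Complex.re_ofReal_mul, Complex.exp_ofReal_mul_I_re, cos_neg]
  ring

/-- In terms of `N = A / β` this is a constant times `N^{3/2} e^{-(1-θ)N}`: a rate `θ < 1` beats the
polynomial loss from the Gaussian width. -/
theorem tendsto_saddle_error {A θ : ℝ} (hA : 0 < A) (hθ : θ < 1) (ω : ℝ) :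
    Tendsto (fun β : ℝ => exp (-(2 * (A / β))) / (β * √(β / A) / ω)
      * (exp (A / β) * exp (θ * (A / β)))) (nhdsWithin 0 (Ioi 0)) (nhds 0) := by
  have hN : Tendsto (fun β : ℝ => A / β) (nhdsWithin 0 (Ioi 0)) atTop := by
    simpa [div_eq_mul_inv] using tendsto_inv_nhdsGT_zero.const_mul_atTop hA
  have h := ((tendsto_rpow_mul_exp_neg_mul_atTop_nhds_zero (3 / 2) (1 - θ) (by linarith)).comp
    hN).const_mul (ω / A)
  rw [mul_zero] at h
  refine h.congr' ?_
  filter_upwards [self_mem_nhdsWithin] with β hβ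
  have hβ : 0 < β := hβ
  simp only [Function.comp_apply]
  have hNpos : 0 < A / β := by positivity
  have e1 : (A / β) ^ (3 / 2 : ℝ) = A / β * √(A / β) := by
    rw [sqrt_eq_rpow, show (3 / 2 : ℝ) = 1 + 1 / 2 by norm_num, rpow_add hNpos, rpow_one]
  have e2 : √(A / β) = (√(β / A))⁻¹ := by rw [← sqrt_inv, inv_div]
  have e3 : exp (-(1 - θ) * (A / β))
      = exp (-(2 * (A / β))) * (exp (A / β) * exp (θ * (A / β))) := by
    rw [← exp_add, ← exp_add]; congr 1; ring
  have hs : √(β / A) ≠ 0 := (sqrt_pos.2 (by positivity)).ne'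
  rw [e1, e2, e3]
  rcases eq_or_ne ω 0 with rfl | hω
  · simp
  field_simp

/-- Asymptotics of band-limited smearings from the behaviour of the Laplace transform near the
origin. -/
theorem tendsto_bandlimited {n : ℝ → ℝ} (hn : ∀ x, 0 ≤ n x)
    (hs : ∀ b, 0 < b → Summable fun x : ℝ => n x * exp (-b * x)) {A a ω κ₀ M ψ₀ : ℝ} (hA : 0 < A)
    (hω : 0 < ω)
    (hlap : ∃ θ < 1, ∃ C : ℝ, ∃ β₀ > 0, ∀ β τ : ℝ, 0 < β → β ≤ β₀ → |τ| ≤ ω →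
      ‖laplaceSum n ⟨β, τ⟩ - κ₀ * Complex.exp (-⟨β, τ⟩ * a) * Complex.exp (A / ⟨β, τ⟩)‖
        ≤ C * exp (θ * (A / β)))
    {ψ : ℝ → ℝ} (hψm : Measurable ψ) (hψ : ∀ t, 0 ≤ t → t ≤ 1 → |ψ t| ≤ M)
    (hψ0 : Tendsto ψ (nhdsWithin 0 (Ioi 0)) (nhds ψ₀)) :
    Tendsto (fun β : ℝ => exp (-(2 * (A / β))) / (β * √(β / A) / ω)
        * (∫ t in (0 : ℝ)..1, (ψ t : ℂ) * (Complex.exp ((⟨β, ω * t⟩ : ℂ) * (A / β ^ 2 : ℝ))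
          * laplaceSum n ⟨β, ω * t⟩)).re)
      (nhdsWithin 0 (Ioi 0)) (nhds (κ₀ * (ψ₀ * (√π / 2)))) := by
  obtain ⟨θ, hθ, C, β₀, hβ₀, hlap⟩ := hlap
  have hM : 0 ≤ M := (abs_nonneg _).trans (hψ 0 le_rfl zero_le_one)
  let P : ℝ → ℝ := fun β => exp (-(2 * (A / β))) / (β * √(β / A) / ω)
  let vac : ℝ → ℝ → ℂ := fun β t => Complex.exp ((⟨β, ω * t⟩ : ℂ) * (A / β ^ 2 : ℝ))
    * (Complex.exp (-⟨β, ω * t⟩ * a) * Complex.exp (A / (⟨β, ω * t⟩ : ℂ)))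
  let full : ℝ → ℝ → ℂ := fun β t => Complex.exp ((⟨β, ω * t⟩ : ℂ) * (A / β ^ 2 : ℝ))
    * laplaceSum n ⟨β, ω * t⟩
  have hvac : Tendsto (fun β => (P β : ℂ) * ∫ t in (0 : ℝ)..1, (ψ t : ℂ) * vac β t)
      (nhdsWithin 0 (Ioi 0)) (nhds ((ψ₀ * (√π / 2) : ℝ) : ℂ)) := by
    refine (tendsto_saddle_integral (a := a) hA hω hψm hψ hψ0).congr fun β => ?_
    simp only [vac, P]
    push_cast
    simp only [mul_assoc]
  have hψint : IntervalIntegrable (fun t => (ψ t : ℂ)) volume 0 1 := by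
    rw [intervalIntegrable_iff_integrableOn_Ioc_of_le zero_le_one]
    refine Measure.integrableOn_of_bounded (M := M) (by simp)
      (Complex.measurable_ofReal.comp hψm).aestronglyMeasurable ?_
    filter_upwards [ae_restrict_mem measurableSet_Ioc] with t ht
    simpa using hψ t ht.1.le ht.2
  -- At the saddle position `A/β²` the factor `e^{sD}` has modulus `e^{A/β}` along the whole
  -- segment, so the assumed bound on the Laplace transform gives the error of
  -- `tendsto_saddle_error`.
  have hdiff : Tendsto (fun β => (P β : ℂ) * (∫ t in (0 : ℝ)..1, (ψ t : ℂ) * full β t)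
      - κ₀ * ((P β : ℂ) * ∫ t in (0 : ℝ)..1, (ψ t : ℂ) * vac β t)) (nhdsWithin 0 (Ioi 0))
      (nhds 0) := by
    have herr := (tendsto_saddle_error hA hθ ω).const_mul (M * C)
    rw [mul_zero] at herr
    refine squeeze_zero_norm' ?_ herr
    filter_upwards [Ioc_mem_nhdsGT hβ₀] with β hβ
    have hβ0 : 0 < β := hβ.1
    have hP : 0 ≤ P β := by positivity
    have hfc : Continuous (full β) := by
      have := continuous_laplaceSum hn (hs β hβ0) ω
      refine Continuous.mul ?_ this
      simp only [Complex.mk_eq_ofReal_add]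
      fun_prop
    have hvc : Continuous (vac β) := by
      have hne : ∀ t : ℝ, ((β : ℂ) + ((ω * t : ℝ) : ℂ) * Complex.I) ≠ 0 := fun t h => by
        have := congrArg Complex.re h
        simp at this
        exact hβ0.ne' this
      simp only [vac, Complex.mk_eq_ofReal_add]
      have : Continuous fun t : ℝ => (A : ℂ) / ((β : ℂ) + ((ω * t : ℝ) : ℂ) * Complex.I) :=
        continuous_const.div (by fun_prop) hne
      fun_prop
    have e : (P β : ℂ) * (∫ t in (0 : ℝ)..1, (ψ t : ℂ) * full β t)
      - κ₀ * ((P β : ℂ) * ∫ t in (0 : ℝ)..1, (ψ t : ℂ) * vac β t)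
      = P β * ∫ t in (0 : ℝ)..1, (ψ t : ℂ) * (full β t - κ₀ * vac β t) := by
      have h1 := intervalIntegral.integral_sub (hψint.mul_continuousOn hfc.continuousOn)
        ((hψint.mul_continuousOn hvc.continuousOn).const_mul (κ₀ : ℂ))
      rw [intervalIntegral.integral_const_mul] at h1
      rw [mul_left_comm (κ₀ : ℂ), ← mul_sub, ← h1]
      congr 2; ext t; ring
    rw [e, norm_mul, Complex.norm_real, norm_of_nonneg hP]
    have hle : ‖∫ t in (0 : ℝ)..1, (ψ t : ℂ) * (full β t - κ₀ * vac β t)‖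
        ≤ M * (exp (A / β) * (C * exp (θ * (A / β)))) * |1 - 0| := by
      refine intervalIntegral.norm_integral_le_of_norm_le_const fun t ht => ?_
      rw [uIoc_of_le zero_le_one] at ht
      have e2 : full β t - κ₀ * vac β t = Complex.exp ((⟨β, ω * t⟩ : ℂ) * (A / β ^ 2 : ℝ))
          * (laplaceSum n ⟨β, ω * t⟩ - κ₀ * Complex.exp (-⟨β, ω * t⟩ * a)
            * Complex.exp (A / ⟨β, ω * t⟩)) := by
        simp only [full, vac]; ring
      rw [e2, norm_mul, norm_mul, Complex.norm_real, Complex.norm_exp, Complex.re_mul_ofReal]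
      have e3 : β * (A / β ^ 2) = A / β := by field_simp
      simp only [e3]
      gcongr
      · exact hψ t ht.1.le ht.2
      · refine hlap β (ω * t) hβ0 hβ.2 ?_
        rw [abs_mul, abs_of_pos hω, abs_of_pos ht.1]
        exact mul_le_of_le_one_right hω.le ht.2
    calc _ ≤ P β * (M * (exp (A / β) * (C * exp (θ * (A / β)))) * |1 - 0|) := by gcongr
      _ = _ := by simp only [P, sub_zero, abs_one]; ring
  have hsum := hdiff.add (hvac.const_mul (κ₀ : ℂ))
  simp only [sub_add_cancel, zero_add] at hsum
  have hre := (Complex.continuous_re.tendsto _).comp hsum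
  rw [Complex.re_ofReal_mul, Complex.ofReal_re] at hre
  refine hre.congr fun β => ?_
  simp only [Function.comp_apply, Complex.re_ofReal_mul]
  rfl

/-! ### The Tauberian theorem -/

/-- In terms of its saddle `β`, the Cardy density is the exponential of the saddle value times the
Gaussian width, hence a constant multiple of the inverse of the prefactor in `tendsto_bandlimited`.
-/
theorem cardyDensity_eq {c β : ℝ} (hc : 0 < c) (hβ : 0 < β) :
    cardyDensity c (π ^ 2 * c / 3 / β ^ 2)
      = exp (2 * (π ^ 2 * c / 3 / β)) * (β * √(β / (π ^ 2 * c / 3)) / (2 * √π)) := by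
  have hpi := pi_pos
  have e1 : √(c * (π ^ 2 * c / 3 / β ^ 2) / 3) = π * c / (3 * β) := by
    rw [show c * (π ^ 2 * c / 3 / β ^ 2) / 3 = (π * c / (3 * β)) ^ 2 by field_simp]
    exact sqrt_sq (by positivity)
  have e2 : c / (48 * (π ^ 2 * c / 3 / β ^ 2) ^ 3)
      = (β * √(β / (π ^ 2 * c / 3)) / (2 * √π)) ^ 4 := by
    have h1 : √(β / (π ^ 2 * c / 3)) ^ 4 = (β / (π ^ 2 * c / 3)) ^ 2 := by
      rw [show (4 : ℕ) = 2 * 2 from rfl, pow_mul, sq_sqrt (by positivity)]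
    have h2 : √π ^ 4 = π ^ 2 := by
      rw [show (4 : ℕ) = 2 * 2 from rfl, pow_mul, sq_sqrt hpi.le]
    rw [div_pow (_ * _), mul_pow β, mul_pow 2, h1, h2]
    field_simp
    ring
  rw [cardyDensity, e1, e2, show (1 / 4 : ℝ) = ((4 : ℕ) : ℝ)⁻¹ by norm_num,
    pow_rpow_inv_natCast (by positivity) (by norm_num), mul_comm]
  congr 2
  field_simp

theorem indicator_Icc_scale {Λ : ℝ} (hΛ : 0 < Λ) (δ D x : ℝ) :
    (Icc (-(Λ * δ)) (Λ * δ)).indicator (1 : ℝ → ℝ) (Λ * (x - D))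
      = (Icc (D - δ) (D + δ)).indicator 1 x := by
  have h : Λ * (x - D) ∈ Icc (-(Λ * δ)) (Λ * δ) ↔ x ∈ Icc (D - δ) (D + δ) := by
    rw [mem_Icc, mem_Icc, ← mul_neg, mul_le_mul_iff_right₀ hΛ, mul_le_mul_iff_right₀ hΛ]
    constructor <;> rintro ⟨h1, h2⟩ <;> constructor <;> linarith
  by_cases hx : x ∈ Icc (D - δ) (D + δ)
  · rw [indicator_of_mem hx, indicator_of_mem (h.2 hx)]; rfl
  · rw [indicator_of_notMem hx, indicator_of_notMem (mt h.1 hx)]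

/-- The weight in a window as a sum over all points. -/
theorem hasSum_window {n : ℝ → ℝ} (hfin : ∀ R, {x : ℝ | x ≤ R ∧ n x ≠ 0}.Finite) (a b : ℝ) :
    HasSum (fun x => n x * (Icc a b).indicator 1 x) (∑ᶠ x ∈ Icc a b, n x) := by
  have e : (fun x => n x * (Icc a b).indicator 1 x) = (Icc a b).indicator n := by
    ext x
    by_cases hx : x ∈ Icc a b
    · rw [indicator_of_mem hx, indicator_of_mem hx, Pi.one_apply, mul_one]
    · rw [indicator_of_notMem hx, indicator_of_notMem hx, mul_zero]
  have hsupp : (Function.support ((Icc a b).indicator n)).Finite := by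
    refine (hfin b).subset fun x hx => ?_
    rw [support_indicator] at hx
    exact ⟨hx.1.2, hx.2⟩
  rw [e, finsum_mem_def, ← tsum_eq_finsum (L := SummationFilter.unconditional ℝ) hsupp]
  exact (summable_of_hasFiniteSupport hsupp).hasSum

/-- The Selberg-smeared weight around `D`, in terms of the Laplace transform. -/
def selbergSmear (n : ℝ → ℝ) (δ Λ σ b D : ℝ) : ℝ :=
  2 * (∫ t in (0 : ℝ)..1, (selbergDensity (Λ * δ) σ t : ℂ)
    * (Complex.exp ((⟨b, 2 * π * Λ * t⟩ : ℂ) * D) * laplaceSum n ⟨b, 2 * π * Λ * t⟩)).re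

theorem hasSum_selbergSmear {n : ℝ → ℝ} (hn : ∀ x, 0 ≤ n x) {b : ℝ}
    (hs : Summable fun x : ℝ => n x * exp (-b * x)) (D : ℝ) {δ Λ : ℝ} (hδ : 0 ≤ δ) (hΛ : 0 ≤ Λ)
    (σ : ℝ) :
    HasSum (fun x : ℝ => n x * exp (-b * (x - D))
        * (2 * ∫ t in (0 : ℝ)..1, selbergDensity (Λ * δ) σ t * cos (2 * π * (Λ * (x - D)) * t)))
      (selbergSmear n δ Λ σ b D) := by
  have h := (hasSum_mul_bandlimited hn hs D (2 * π * Λ) (measurable_selbergDensity (Λ * δ) σ)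
    (fun t h0 h1 => abs_selbergDensity_le (σ := σ) (by positivity) h0 h1)).mul_left 2
  simp only [mul_left_comm (2 : ℝ)] at h
  simpa only [selbergSmear, ← mul_assoc] using h

/-- On the window the damping `e^{-b(x-D)}` is at least `e^{-bδ}`; outside it positivity of the
weights and the majorant property suffice. The factor `e^{bδ}` tends to `1` with `b → 0`, as does
its inverse in `selbergSmear_le_window`. -/
theorem window_le_selbergSmear {n : ℝ → ℝ} (hn : ∀ x, 0 ≤ n x)
    (hfin : ∀ R, {x : ℝ | x ≤ R ∧ n x ≠ 0}.Finite) {b : ℝ} (hb : 0 ≤ b)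
    (hs : Summable fun x : ℝ => n x * exp (-b * x)) (D : ℝ) {δ Λ : ℝ} (hδ : 0 ≤ δ) (hΛ : 0 < Λ) :
    ∑ᶠ x ∈ Icc (D - δ) (D + δ), n x ≤ exp (b * δ) * selbergSmear n δ Λ 1 b D := by
  refine hasSum_le (fun x => ?_) (hasSum_window hfin _ _)
    ((hasSum_selbergSmear hn hs D hδ hΛ.le 1).mul_left (exp (b * δ)))
  have h := indicator_le_selberg (r := Λ * δ) (by positivity) (Λ * (x - D))
  rw [indicator_Icc_scale hΛ] at h
  have hw : (Icc (D - δ) (D + δ)).indicator (1 : ℝ → ℝ) x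
      ≤ exp (b * δ) * exp (-b * (x - D)) * (Icc (D - δ) (D + δ)).indicator (1 : ℝ → ℝ) x := by
    by_cases hx : x ∈ Icc (D - δ) (D + δ)
    · rw [indicator_of_mem hx, Pi.one_apply, mul_one, ← exp_add]
      refine one_le_exp ?_
      have := hx.2
      nlinarith
    · rw [indicator_of_notMem hx, mul_zero]
  have h2 := mul_le_mul_of_nonneg_left (hw.trans (mul_le_mul_of_nonneg_left h (by positivity)))
    (hn x)
  refine h2.trans_eq ?_
  ring

theorem selbergSmear_le_window {n : ℝ → ℝ} (hn : ∀ x, 0 ≤ n x)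
    (hfin : ∀ R, {x : ℝ | x ≤ R ∧ n x ≠ 0}.Finite) {b : ℝ} (hb : 0 ≤ b)
    (hs : Summable fun x : ℝ => n x * exp (-b * x)) (D : ℝ) {δ Λ : ℝ} (hδ : 0 ≤ δ) (hΛ : 0 < Λ) :
    exp (-(b * δ)) * selbergSmear n δ Λ (-1) b D ≤ ∑ᶠ x ∈ Icc (D - δ) (D + δ), n x := by
  refine hasSum_le (fun x => ?_) ((hasSum_selbergSmear hn hs D hδ hΛ.le (-1)).mul_left
    (exp (-(b * δ)))) (hasSum_window hfin _ _)
  have h := selberg_le_indicator (r := Λ * δ) (by positivity) (Λ * (x - D))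
  rw [indicator_Icc_scale hΛ] at h
  have hw : exp (-(b * δ)) * exp (-b * (x - D)) * (Icc (D - δ) (D + δ)).indicator (1 : ℝ → ℝ) x
      ≤ (Icc (D - δ) (D + δ)).indicator (1 : ℝ → ℝ) x := by
    by_cases hx : x ∈ Icc (D - δ) (D + δ)
    · rw [indicator_of_mem hx, Pi.one_apply, mul_one, ← exp_add]
      refine exp_le_one_iff.2 ?_
      have := hx.1
      nlinarith
    · rw [indicator_of_notMem hx, mul_zero]
  have h2 := mul_le_mul_of_nonneg_left ((mul_le_mul_of_nonneg_left h (by positivity)).trans hw)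
    (hn x)
  refine Eq.trans_le ?_ h2
  ring

/-- A Tauberian theorem with Beurling-Selberg constants: if the Laplace transform of a positive
measure is governed by `κ₀ e^{-as + A/s}` near the segment `|Im s| < 2π`, the measure of windows of
radius `δ` grows like the Cardy density, up to a factor between `1 - 1/(2δ)` and `1 + 1/(2δ)`. -/
theorem eventually_window_bounds {n : ℝ → ℝ} (hn : ∀ x, 0 ≤ n x)
    (hfin : ∀ R, {x : ℝ | x ≤ R ∧ n x ≠ 0}.Finite)
    (hs : ∀ b, 0 < b → Summable fun x : ℝ => n x * exp (-b * x)) {c a κ₀ : ℝ} (hc : 0 < c)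
    (hκ₀ : 0 < κ₀)
    (hlap : ∀ Λ, 0 < Λ → Λ < 1 → ∃ θ < 1, ∃ C : ℝ, ∃ β₀ > 0, ∀ β τ : ℝ, 0 < β → β ≤ β₀ →
      |τ| ≤ 2 * π * Λ →
      ‖laplaceSum n ⟨β, τ⟩ - κ₀ * Complex.exp (-⟨β, τ⟩ * a)
          * Complex.exp ((π ^ 2 * c / 3 : ℝ) / ⟨β, τ⟩)‖
        ≤ C * exp (θ * (π ^ 2 * c / 3 / β)))
    {δ ε : ℝ} (hδ : 0 < δ) (hε : 0 < ε) :
    ∀ᶠ D : ℝ in atTop,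
      (1 - 1 / (2 * δ) - ε) * κ₀ * cardyDensity c D
        ≤ 1 / (2 * δ) * ∑ᶠ x ∈ Icc (D - δ) (D + δ), n x ∧
      1 / (2 * δ) * ∑ᶠ x ∈ Icc (D - δ) (D + δ), n x
        ≤ (1 + 1 / (2 * δ) + ε) * κ₀ * cardyDensity c D := by
  have hpi := pi_pos
  set A : ℝ := π ^ 2 * c / 3 with hAdef
  have hA : 0 < A := by positivity
  -- With this bandwidth `1/(2δΛ) = 1/(2δ) + ε/2`; the other half of `ε` is spent on convergence,
  -- through `hgap`.
  let Λ : ℝ := 1 / (1 + δ * ε)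
  have hδε : 0 < δ * ε := by positivity
  have hΛ : 0 < Λ := by positivity
  have hΛ1 : Λ < 1 := by
    rw [div_lt_one (by positivity)]; linarith
  have hΛinv : Λ * (1 + δ * ε) = 1 := by simp only [Λ]; field_simp
  have hω : 0 < 2 * π * Λ := by positivity
  let P : ℝ → ℝ := fun β => exp (-(2 * (A / β))) / (β * √(β / A) / (2 * π * Λ))
  have hlim : ∀ σ : ℝ, Tendsto (fun β : ℝ => exp (σ * (β * δ)) * (P β
      * selbergSmear n δ Λ σ β (A / β ^ 2))) (nhdsWithin 0 (Ioi 0))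
      (nhds (κ₀ * (2 * (Λ * δ) + σ) * √π)) := by
    intro σ
    have h1 := (tendsto_bandlimited hn hs hA hω (hlap Λ hΛ hΛ1)
      (measurable_selbergDensity (Λ * δ) σ)
      (fun t h0 h1 => abs_selbergDensity_le (σ := σ) (by positivity) h0 h1)
      (tendsto_selbergDensity (Λ * δ) σ)).const_mul 2
    have h2 : Tendsto (fun β : ℝ => exp (σ * (β * δ))) (nhdsWithin 0 (Ioi 0)) (nhds 1) := by
      have : Continuous fun β : ℝ => exp (σ * (β * δ)) := by fun_prop
      exact (this.tendsto' 0 1 (by simp)).mono_left nhdsWithin_le_nhds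
    have h3 := h2.mul h1
    have e : 1 * (2 * (κ₀ * ((2 * (Λ * δ) + σ) * (√π / 2)))) = κ₀ * (2 * (Λ * δ) + σ) * √π := by
      ring
    rw [e] at h3
    refine h3.congr fun β => ?_
    simp only [selbergSmear, P]
    ring
  have hsq : 0 < √π := sqrt_pos.2 hpi
  have hgap : 0 < κ₀ * (Λ * (δ * ε)) * √π := by positivity
  have hup := (hlim 1).eventually (gt_mem_nhds (lt_add_of_pos_right _ hgap))
  have hlow := (hlim (-1)).eventually (lt_mem_nhds (sub_lt_self _ hgap))
  -- The critical point of `sD + A/s`; it tends to zero as `D` grows.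
  have hβ : Tendsto (fun D : ℝ => √(A / D)) atTop (nhdsWithin 0 (Ioi 0)) := by
    refine tendsto_nhdsWithin_iff.2 ⟨?_, ?_⟩
    · have h : Tendsto (fun D : ℝ => A / D) atTop (nhds 0) := tendsto_const_nhds.div_atTop tendsto_id
      have := (continuous_sqrt.tendsto 0).comp h
      rwa [sqrt_zero] at this
    · filter_upwards [eventually_gt_atTop 0] with D hD
      exact sqrt_pos.2 (by positivity)
  filter_upwards [hβ.eventually hup, hβ.eventually hlow, eventually_gt_atTop 0] with D h1 h2 hD
  have hβ0 : 0 < √(A / D) := sqrt_pos.2 (by positivity)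
  have hβsq : √(A / D) ^ 2 = A / D := sq_sqrt (by positivity)
  set β := √(A / D) with hβdef
  have hDβ : A / β ^ 2 = D := by rw [hβsq]; field_simp
  have hcardy : cardyDensity c D = exp (2 * (A / β)) * (β * √(β / A) / (2 * √π)) := by
    rw [← hDβ]; exact cardyDensity_eq hc hβ0
  have hcpos : 0 < cardyDensity c D := by
    have : 0 < √(β / A) := sqrt_pos.2 (by positivity)
    rw [hcardy]; positivity
  have hP : P β * cardyDensity c D = √π * Λ := by
    have : √(β / A) ≠ 0 := (sqrt_pos.2 (by positivity)).ne'
    have hee : exp (-(2 * (A / β))) * exp (2 * (A / β)) = 1 := by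
      rw [← exp_add, neg_add_cancel, exp_zero]
    have hpp : √π * √π = π := mul_self_sqrt hpi.le
    calc P β * cardyDensity c D
        = exp (-(2 * (A / β))) * exp (2 * (A / β)) * (π * Λ / √π) := by
          rw [hcardy]; simp only [P]; field_simp
      _ = √π * Λ := by
          rw [hee, one_mul, div_eq_iff hsq.ne']
          linear_combination (-Λ) * hpp
  have hPpos : 0 < P β := pos_of_mul_pos_left (by rw [hP]; positivity) hcpos.le
  have key1 := window_le_selbergSmear hn hfin hβ0.le (hs β hβ0) D hδ.le hΛ
  have key2 := selbergSmear_le_window hn hfin hβ0.le (hs β hβ0) D hδ.le hΛ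
  rw [hDβ] at h1 h2
  set w := ∑ᶠ x ∈ Icc (D - δ) (D + δ), n x with hw
  have hscale : ∀ q : ℝ, P β * (q * (κ₀ * cardyDensity c D)) = q * κ₀ * (√π * Λ) := fun q => by
    rw [← hP]; ring
  constructor
  · have hle : (2 * δ - 1 - 2 * (δ * ε)) * (κ₀ * cardyDensity c D) ≤ w := by
      refine le_of_mul_le_mul_left ?_ hPpos
      rw [hscale]
      have h3 := mul_le_mul_of_nonneg_left key2 hPpos.le
      have e1 : P β * (exp (-(β * δ)) * selbergSmear n δ Λ (-1) β D)
          = exp (-1 * (β * δ)) * (P β * selbergSmear n δ Λ (-1) β D) := by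
        rw [neg_one_mul]; ring
      rw [e1] at h3
      refine le_trans (le_of_eq ?_) (h2.le.trans h3)
      linear_combination κ₀ * √π * hΛinv * (-1)
    rw [one_div, inv_mul_eq_div, le_div_iff₀ (by positivity)]
    refine le_trans (le_of_eq ?_) hle
    field_simp
  · have hle : w ≤ (2 * δ + 1 + 2 * (δ * ε)) * (κ₀ * cardyDensity c D) := by
      refine le_of_mul_le_mul_left ?_ hPpos
      rw [hscale]
      have h3 := mul_le_mul_of_nonneg_left key1 hPpos.le
      have e1 : P β * (exp (β * δ) * selbergSmear n δ Λ 1 β D)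
          = exp (1 * (β * δ)) * (P β * selbergSmear n δ Λ 1 β D) := by
        rw [one_mul]; ring
      rw [e1] at h3
      refine (h3.trans h1.le).trans (le_of_eq ?_)
      linear_combination κ₀ * √π * hΛinv * (-1)
    rw [one_div, inv_mul_eq_div, div_le_iff₀ (by positivity)]
    refine hle.trans (le_of_eq ?_)
    field_simp

end

/-! ### Growth of the number of states in each irrep -/

theorem theorem4p2 {G V W : Type*} [Group G] [Fintype G]
    [NormedAddCommGroup V] [InnerProductSpace ℂ V]
    [AddCommGroup W] [Module ℂ W] [FiniteDimensional ℂ W]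
    (X : SymmetricCFT G V) (hc : 0 < X.c)
    (hgap : ∀ g : G, g ≠ 1 → X.level g 0 = ⊥)
    (g₀ : G) (α : Representation ℂ G W) [α.IsIrreducible] :
    -- the partition function of the operators in the irrep `α` of the sector twisted by `g₀`
    (∀ β : ℝ, 0 < β →
      HasSum (fun Δ : ℝ =>
          (X.irrepCount α g₀ Δ : ℂ) * (Real.exp (-β * (Δ - X.c / 12)) : ℂ))
        ((Module.finrank ℂ W : ℂ) / (Fintype.card G : ℂ)
          * ∑ g : G, X.Z β g₀ g * (starRingEnd ℂ) (α.character g))) ∧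
    -- the asymptotic growth, with `c₋ = 1 - 1 / (2δ)` and `c₊ = 1 + 1 / (2δ)`
    (∀ δ : ℝ, 0 < δ → ∀ ε : ℝ, 0 < ε → ∀ᶠ Δ : ℝ in atTop,
      (1 - 1 / (2 * δ) - ε) * (Module.finrank ℂ W : ℝ) ^ 2 / (Fintype.card G : ℝ)
          * cardyDensity X.c Δ
        ≤ 1 / (2 * δ) * ∑ᶠ Δ' ∈ Set.Icc (Δ - δ) (Δ + δ), X.irrepCount α g₀ Δ' ∧
      1 / (2 * δ) * ∑ᶠ Δ' ∈ Set.Icc (Δ - δ) (Δ + δ), X.irrepCount α g₀ Δ'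
        ≤ (1 + 1 / (2 * δ) + ε) * (Module.finrank ℂ W : ℝ) ^ 2 / (Fintype.card G : ℝ)
          * cardyDensity X.c Δ) := by
  refine ⟨fun β hβ => X.hasSum_irrepCount α g₀ hβ, fun δ hδ ε hε => ?_⟩
  -- An irreducible representation has two distinct subrepresentations, hence is nonzero; this makes
  -- the constant `d² / |G|` positive.
  have hW : Nontrivial W := by
    by_contra hcon
    rw [not_nontrivial_iff_subsingleton] at hcon
    obtain ⟨p, q, hpq⟩ := (inferInstance : Nontrivial (Subrepresentation α))
    exact hpq (SetLike.ext fun w => by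
      rw [Subsingleton.elim w 0]; exact iff_of_true p.toSubmodule.zero_mem q.toSubmodule.zero_mem)
  have hd : 0 < (Module.finrank ℂ W : ℝ) := by exact_mod_cast Module.finrank_pos
  have hsum : ∀ b : ℝ, 0 < b → Summable fun x : ℝ => X.irrepCount α g₀ x * Real.exp (-b * x) := by
    intro b hb
    have h := (X.hasSum_irrepCount_mul_exp α g₀ (s := b) (by simpa using hb)).summable.norm
    refine h.congr fun x => ?_
    rw [norm_mul_exp_neg (X.irrepCount_nonneg α g₀), Complex.ofReal_re]
  have hlap : ∀ Λ, 0 < Λ → Λ < 1 → ∃ θ < 1, ∃ C : ℝ, ∃ β₀ > 0, ∀ β τ : ℝ, 0 < β → β ≤ β₀ →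
      |τ| ≤ 2 * Real.pi * Λ →
      ‖laplaceSum (X.irrepCount α g₀) ⟨β, τ⟩
          - ((Module.finrank ℂ W : ℝ) ^ 2 / (Fintype.card G : ℝ) : ℝ)
            * Complex.exp (-⟨β, τ⟩ * (X.c / 12 : ℝ))
            * Complex.exp ((Real.pi ^ 2 * X.c / 3 : ℝ) / ⟨β, τ⟩)‖
        ≤ C * Real.exp (θ * (Real.pi ^ 2 * X.c / 3 / β)) := by
    intro Λ hΛ hΛ1
    have h12 : ((X.c / 12 : ℝ) : ℂ) = X.c / 12 := by push_cast; rfl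
    rw [h12]
    exact X.exists_laplace_bound hc hgap g₀ α hΛ hΛ1
  have hκ : 0 < (Module.finrank ℂ W : ℝ) ^ 2 / (Fintype.card G : ℝ) := by
    have : 0 < (Fintype.card G : ℝ) := by exact_mod_cast Fintype.card_pos
    positivity
  have hwin := eventually_window_bounds (X.irrepCount_nonneg α g₀) (X.irrepCount_finite α g₀) hsum
    hc hκ hlap hδ hε
  simp only [mul_div_assoc]
  exact hwin
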